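/- **Setting.** Let $M$ be a smooth $n$-dimensional manifold with an $(\overline L_n,g)$-structure, i.e. a contravariant affine connection $\nabla_{\partial_k}\partial_j=\Gamma^i_{jk}\partial_i$ (torsion allowed), a covariant affine connection $\nabla_{\partial_k}dx^i=P^i_{jk}\,dx^j$, an invertible tensor field $f^i{}_j=S(dx^i,\partial_j)$ (the contraction operator $S$) that commutes with covariant differentiation, $\partial_kf^i{}_j=\Gamma^l_{jk}f^i{}_l+P^i_{lk}f^l{}_j$, and a symmetric non-degenerate covariant metric $g_{ij}$. Put $p_{\bar j}=f^i{}_jp_i$, $u^{\bar i}=f^i{}_ju^j$, and let $g^{ij}$ be the inverse matrix of $g_{\bar i\bar j}$. Indices of differentiation are natural ones, i.e. $\nabla_\xi V=\xi^kV_{;k}$. Barred covariant indices, differentiation indices, and indices of derivatives of $L$ with respect to field variables are differentiated with $\Gamma$ in the usual way. A Lagrangian system consists of finitely many smooth tensor fields $V^A{}_B$ of arbitrary finite ranks and a Lagrangian invariant $L=L(g,\nabla g,\nabla\nabla g,V,\nabla V,\nabla\nabla V)$. Here $L$ is a smooth $GL(n)$-invariant function on a $GL(n)$-stable open set of arguments,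 evaluated at the components in which all covariant indices are contracted by $S$ (barred). Let $\phi$ run over all field variables (the metric $g$ and the $V$'s, with barred covariant indices), and let $(S\phi)_\alpha{}^\beta$ be the coefficient of $\xi^\alpha{}_{;\beta}$ in $\pounds_\xi\phi$, i.e. $(S\phi)_\alpha{}^{\beta\,A}{}_B=\sum_m\delta^\beta_{B_m}\phi^A{}_{\ldots\alpha\ldots}-\sum_m\delta^{A_m}_\alpha\phi^{\ldots\beta\ldots}{}_B$, where the displayed index stands in the $m$-th place. With $\pi^k=\frac{\partial L}{\partial\phi_{;k}}-\big(\frac{\partial L}{\partial\phi_{;k;l}}\big)_{;l}$ and $q^{kl}=\frac{\partial L}{\partial\phi_{;k;l}}$ let $$\frac{\delta L}{\delta\phi}=\frac{\partial L}{\partial\phi}-\Big(\frac{\partial L}{\partial\phi_{;k}}\Big)_{;k}+\Big(\frac{\partial L}{\partial\phi_{;k;l}}\Big)_{;l;k},\qquad Q_\alpha{}^\beta=-\sum_\phi\frac{\delta L}{\delta\phi}\,(S\phi)_\alpha{}^\beta,$$ $$t_\alpha{}^\beta=\sum_\phi\big(\pi^\beta\phi_{;\alpha}+q^{k\beta}\phi_{;k;\alpha}\big)-L\,\delta_\alpha^\beta,\qquad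 U_\alpha{}^{\beta\gamma}=\sum_\phi\big(\pi^\gamma(S\phi)_\alpha{}^\beta+q^{k\gamma}(S\phi_{;k})_\alpha{}^\beta+q^{\beta\gamma}\phi_{;\alpha}\big),$$ where in $S\phi_{;k}$ the operator acts on the indices of $\phi$ only. Raise the first index, $U^{\alpha\beta\gamma}=g^{\alpha\delta}U_\delta{}^{\beta\gamma}$, put $s^{\alpha\beta\gamma}=\tfrac12(U^{\alpha\beta\gamma}-U^{\beta\alpha\gamma})$, and let $B^{\alpha\beta\gamma}=s^{\alpha\beta\gamma}+s^{\gamma\alpha\beta}+s^{\gamma\beta\alpha}$ be the Belinfante combination (antisymmetric in $\beta,\gamma$) and $\Psi=U-B$ (symmetric in $\alpha,\beta$). The symmetric Belinfante tensor ${}_sT$ and the generalized canonical energy-momentum tensor $\theta$ are $${}_sT_\alpha{}^\beta=-g_{\bar\alpha\bar\delta}\Psi^{\delta\beta\gamma}{}_{;\gamma}-L\,\delta_\alpha^\beta,\qquad \theta_\alpha{}^\beta=t_\alpha{}^\beta-K_\alpha{}^\beta-W_\alpha{}^{\beta\gamma}{}_{;\gamma},$$ $$K_\alpha{}^\beta=-g_{\bar\alpha\bar\delta;\gamma}\Psi^{\delta\beta\gamma},\qquad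 W_\alpha{}^{\beta\gamma}=-g_{\bar\alpha\bar\delta}B^{\delta\beta\gamma}.$$ $Q$ is the variational Euler–Lagrange energy-momentum tensor. All three are regarded as tensors $G=G_\alpha{}^\beta\,\partial_\beta\otimes dx^\alpha$. Let $u$ be a smooth contravariant vector field that is non-null: $e=g(u,u)=g_{\bar i\bar j}u^iu^j\neq0$ everywhere. The rest mass densities are $$\rho_\theta=\frac1{e^2}\,g_{\bar\alpha\bar\beta}u^\beta\,\theta_\gamma{}^\alpha u^{\bar\gamma},\qquad \rho_T=\frac1{e^2}\,g_{\bar\alpha\bar\beta}u^\beta\,{}_sT_\gamma{}^\alpha u^{\bar\gamma},\qquad \rho_Q=-\frac1{e^2}\,g_{\bar\alpha\bar\beta}u^\beta\,Q_\gamma{}^\alpha u^{\bar\gamma}.$$ **Proposition.** $\rho_\theta=\rho_T$ on $M$ if and only if $\rho_Q=0$ on $M$. The equivalence also holds at each point: for every $p\in M$ (and with the components taken in any chart of the atlas around $p$), $\rho_\theta(p)=\rho_T(p)$ if and only if $\rho_Q(p)=0$. -/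

import Mathlib

open scoped Manifold ContDiff

noncomputable section

namespace LbarGeometry

/-! Tensor arrays and their algebra -/

/-- Points of a coordinate domain. -/
abbrev Coord (n : ℕ) : Type := EuclideanSpace ℝ (Fin n)

/-- Components `T^A_B` of a tensor with `r` upper and `s` lower indices at one point. -/
abbrev Ten (n r s : ℕ) : Type := (Fin r → Fin n) → (Fin s → Fin n) → ℝ

/-- Coefficients of a connection at one point, `C i j k = C^i_{jk}`, where `k` is the index of the
direction of differentiation. -/
abbrev Conn (n : ℕ) : Type := Fin n → Fin n → Fin n → ℝ

/-- The action of an invertible matrix `J` with inverse `Ji` on tensor components: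
every upper index is transformed by `J`, every lower one by `Ji`. -/
def tensorAct {n r s : ℕ} (J Ji : Matrix (Fin n) (Fin n) ℝ) (T : Ten n r s) : Ten n r s :=
  fun A B => ∑ C : Fin r → Fin n, ∑ D : Fin s → Fin n,
    (∏ m, J (A m) (C m)) * (∏ m, Ji (D m) (B m)) * T C D

/-- Contraction of the `m`-th lower index with the matrix `F m`, for every `m`. -/
def contractLower {n r s : ℕ} (F : Fin s → Matrix (Fin n) (Fin n) ℝ) (T : Ten n r s) : Ten n r s :=
  fun A B => ∑ D : Fin s → Fin n, (∏ m, F m (D m) (B m)) * T A D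

/-- `S_α^β T`: the coefficient of `ξ^α_{;β}` in the Lie derivative of `T` along `ξ`, that is
`- ∑ δ^{A_m}_α T^{.. β ..}_B + ∑ δ^β_{B_m} T^A_{.. α ..}`. -/
def lieGen {n r s : ℕ} (α β : Fin n) (T : Ten n r s) : Ten n r s :=
  fun A B =>
    (∑ m : Fin s, if B m = β then T A (Function.update B m α) else 0)
      - ∑ m : Fin r, if A m = α then T (Function.update A m β) B else 0

/-! Calculus in a coordinate domain -/

/-- The partial derivative `∂F/∂x^k`. -/
def partialD {n : ℕ} (k : Fin n) (F : Coord n → ℝ) (x : Coord n) : ℝ :=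
  fderiv ℝ F x (EuclideanSpace.single k 1)

/-- Covariant derivative of a tensor field: the upper indices are differentiated with `Γ`, the
`m`-th lower index with `Λ m`.  The index of differentiation is appended as the last lower index:
`T^A_{B;k} = ∂_k T^A_B + ∑ Γ^{A_m}_{lk} T^{..l..}_B + ∑ Λ_m^l_{B_m k} T^A_{..l..}`. -/
def covD {n r s : ℕ} (Γ : Coord n → Conn n) (Λ : Fin s → Coord n → Conn n)
    (T : Coord n → Ten n r s) (x : Coord n) : Ten n r (s + 1) :=
  fun A B' =>
    let B : Fin s → Fin n := Fin.init B'
    let k : Fin n := B' (Fin.last s)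
    partialD k (fun y => T y A B) x
      + (∑ m : Fin r, ∑ l : Fin n, Γ x (A m) l k * T x (Function.update A m l) B)
      + ∑ m : Fin s, ∑ l : Fin n, Λ m x l (B m) k * T x A (Function.update B m l)

/-- The connection on lower indices dual to `Γ` under the natural pairing of upper and lower
indices. -/
def dualConn {n : ℕ} (Γ : Coord n → Conn n) : Coord n → Conn n :=
  fun x i j k => - Γ x i j k

/-- Covariant derivative of a tensor all of whose lower indices are dual to upper ones in the
natural pairing. -/
def nabla {n r s : ℕ} (Γ : Coord n → Conn n) (T : Coord n → Ten n r s) :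
    Coord n → Ten n r (s + 1) :=
  covD Γ (fun _ => dualConn Γ) T

/-- Covariant divergence over the last upper index: `T^{Ak}_{B;k}`. -/
def divLast {n r s : ℕ} (Γ : Coord n → Conn n) (T : Coord n → Ten n (r + 1) s) (x : Coord n) :
    Ten n r s :=
  fun A B => ∑ k : Fin n,
    nabla Γ T x (Fin.snoc (α := fun _ => Fin n) A k) (Fin.snoc (α := fun _ => Fin n) B k)

/-! Tensor fields and connections on a manifold, through their components in the charts -/

section Manifold

variable {n : ℕ} {M : Type*} [TopologicalSpace M]

/-- The Jacobian matrix `∂x'^i/∂x^a` of the change from the chart `e` to the chart `e'`, as a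
function of the `e`-coordinates. -/
def jac (e e' : OpenPartialHomeomorph M (Coord n)) (x : Coord n) : Matrix (Fin n) (Fin n) ℝ :=
  fun i a => partialD a (fun y => e' (e.symm y) i) x

variable (n M) [ChartedSpace (EuclideanSpace ℝ (Fin n)) M]

/-- A smooth tensor field with `r` contravariant and `s` covariant indices, given by its
components with respect to `∂_i` and `dx^i` in every chart of the atlas. -/
structure TensorField (r s : ℕ) where
  comp : OpenPartialHomeomorph M (Coord n) → Coord n → Ten n r s
  smooth : ∀ e ∈ atlas (EuclideanSpace ℝ (Fin n)) M, ∀ A B,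
    ContDiffOn ℝ ∞ (fun x => comp e x A B) e.target
  transform : ∀ e ∈ atlas (EuclideanSpace ℝ (Fin n)) M,
    ∀ e' ∈ atlas (EuclideanSpace ℝ (Fin n)) M, ∀ p ∈ e.source ∩ e'.source,
    comp e' (e' p) = tensorAct (jac e e' (e p)) (jac e' e (e' p)) (comp e (e p))

/-- A contravariant affine connection, `∇_{∂_k} ∂_j = Γ^i_{jk} ∂_i` (torsion is allowed). -/
structure ContravariantConnection where
  coeff : OpenPartialHomeomorph M (Coord n) → Coord n → Conn n
  smooth : ∀ e ∈ atlas (EuclideanSpace ℝ (Fin n)) M, ∀ i j k,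
    ContDiffOn ℝ ∞ (fun x => coeff e x i j k) e.target
  transform : ∀ e ∈ atlas (EuclideanSpace ℝ (Fin n)) M,
    ∀ e' ∈ atlas (EuclideanSpace ℝ (Fin n)) M, ∀ p ∈ e.source ∩ e'.source, ∀ i j k,
    coeff e' (e' p) i j k =
      (∑ a, ∑ b, ∑ c, jac e e' (e p) i a * jac e' e (e' p) b j * jac e' e (e' p) c k
        * coeff e (e p) a b c)
      + ∑ a, jac e e' (e p) i a * partialD k (fun y => jac e' e y a j) (e' p)

/-- A covariant affine connection, `∇_{∂_k} dx^i = P^i_{jk} dx^j`. -/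
structure CovariantConnection where
  coeff : OpenPartialHomeomorph M (Coord n) → Coord n → Conn n
  smooth : ∀ e ∈ atlas (EuclideanSpace ℝ (Fin n)) M, ∀ i j k,
    ContDiffOn ℝ ∞ (fun x => coeff e x i j k) e.target
  transform : ∀ e ∈ atlas (EuclideanSpace ℝ (Fin n)) M,
    ∀ e' ∈ atlas (EuclideanSpace ℝ (Fin n)) M, ∀ p ∈ e.source ∩ e'.source, ∀ i j k,
    coeff e' (e' p) i j k =
      (∑ a, ∑ b, ∑ c, jac e e' (e p) i a * jac e' e (e' p) b j * jac e' e (e' p) c k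
        * coeff e (e p) a b c)
      + ∑ b, ∑ c, partialD c (fun y => jac e e' y i b) (e p)
        * jac e' e (e' p) b j * jac e' e (e' p) c k

/-- An `(L̄_n, g)`-space: a manifold with a contravariant connection `Γ`, a covariant connection
`P`, a contraction operator `S` with components `f^i_j = S(dx^i, ∂_j)` which commutes with the
covariant differentiation, and a (pseudo-Riemannian) metric `g`. -/
structure LbarSpace where
  Γ : ContravariantConnection n M
  P : CovariantConnection n M
  f : TensorField n M 1 1
  g : TensorField n M 0 2
  f_nondegenerate : ∀ e ∈ atlas (EuclideanSpace ℝ (Fin n)) M, ∀ x ∈ e.target,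
    (Matrix.of fun i j => f.comp e x (fun _ => i) (fun _ => j)).det ≠ 0
  /-- `∂_k f^i_j = Γ^l_{jk} f^i_l + P^i_{lk} f^l_j`. -/
  f_compatible : ∀ e ∈ atlas (EuclideanSpace ℝ (Fin n)) M, ∀ x ∈ e.target, ∀ i j k,
    partialD k (fun y => f.comp e y (fun _ => i) (fun _ => j)) x =
      (∑ l, Γ.coeff e x l j k * f.comp e x (fun _ => i) (fun _ => l))
        + ∑ l, P.coeff e x i l k * f.comp e x (fun _ => l) (fun _ => j)
  g_symmetric : ∀ e ∈ atlas (EuclideanSpace ℝ (Fin n)) M, ∀ x ∈ e.target, ∀ i j,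
    g.comp e x ![] ![i, j] = g.comp e x ![] ![j, i]
  g_nondegenerate : ∀ e ∈ atlas (EuclideanSpace ℝ (Fin n)) M, ∀ x ∈ e.target,
    (Matrix.of fun i j => g.comp e x ![] ![i, j]).det ≠ 0

end Manifold

namespace LbarSpace

variable {n : ℕ} {M : Type*} [TopologicalSpace M] [ChartedSpace (EuclideanSpace ℝ (Fin n)) M]

/-- The matrix `f^i_j` of the contraction operator. -/
def fMat (X : LbarSpace n M) (e : OpenPartialHomeomorph M (Coord n)) (x : Coord n) :
    Matrix (Fin n) (Fin n) ℝ :=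
  fun i j => X.f.comp e x (fun _ => i) (fun _ => j)

/-- `g_{īj̄} = f^k_i f^l_j g_{kl}`, so that `g(u, v) = g_{īj̄} u^i v^j`. -/
def gBar (X : LbarSpace n M) (e : OpenPartialHomeomorph M (Coord n)) (x : Coord n) :
    Matrix (Fin n) (Fin n) ℝ :=
  fun i j => ∑ k, ∑ l, X.fMat e x k i * X.fMat e x l j * X.g.comp e x ![] ![k, l]

/-- Components `g^{ij}` of the contravariant metric `ḡ`, determined by `ḡ(g(v)) = v`, that is
`g^{ik} g_{k̄l̄} = δ^i_l`. -/
def gInv (X : LbarSpace n M) (e : OpenPartialHomeomorph M (Coord n)) (x : Coord n) :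
    Matrix (Fin n) (Fin n) ℝ :=
  (X.gBar e x)⁻¹

/-- Components `u^i` of a contravariant vector field. -/
def vec (u : TensorField n M 1 0) (e : OpenPartialHomeomorph M (Coord n)) (x : Coord n) :
    Fin n → ℝ :=
  fun i => u.comp e x (fun _ => i) ![]

/-- `g(u, u) = g_{īj̄} u^i u^j`. -/
def normSq (X : LbarSpace n M) (u : TensorField n M 1 0)
    (e : OpenPartialHomeomorph M (Coord n)) (x : Coord n) : ℝ :=
  ∑ i, ∑ j, X.gBar e x i j * vec u e x i * vec u e x j

/-- `u` is non-null (non-isotropic): `g(u, u) ≠ 0` everywhere. -/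
def NonNull (X : LbarSpace n M) (u : TensorField n M 1 0) : Prop :=
  ∀ e ∈ atlas (EuclideanSpace ℝ (Fin n)) M, ∀ x ∈ e.target, X.normSq u e x ≠ 0

/-- `(1/e²) [g(u)](G)(u) = (1/e²) g_{ᾱβ̄} u^β G_γ^α u^γ̄` with `e = g(u, u)` and
`u^γ̄ = f^γ_δ u^δ`, for a mixed tensor field `G = G_γ^α ∂_α ⊗ dx^γ` of the first type; here
`G γ α = G_γ^α`. -/
def uProjection (X : LbarSpace n M) (u : TensorField n M 1 0)
    (e : OpenPartialHomeomorph M (Coord n)) (x : Coord n) (G : Fin n → Fin n → ℝ) : ℝ :=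
  1 / (X.normSq u e x) ^ 2 *
    ∑ α, ∑ β, ∑ γ, ∑ δ,
      X.gBar e x α β * vec u e x β * G γ α * (X.fMat e x γ δ * vec u e x δ)

end LbarSpace

/-! Lagrangian invariants and Lagrangian systems -/

/-- The ranks of all field variables: `none` is the metric, `some a` is the field `V_a`. -/
def rank {ι : Type*} (τ : ι → ℕ × ℕ) : Option ι → ℕ × ℕ
  | none => (0, 2)
  | some a => τ a

/-- Values of the components of a tensor and of its first two covariant derivatives. -/
abbrev Jet (n r s : ℕ) : Type := Ten n r s × Ten n r (s + 1) × Ten n r (s + 2)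

/-- The space of arguments `(g, ∇g, ∇∇g, V, ∇V, ∇∇V)` of a Lagrangian. -/
abbrev JetSpace (n : ℕ) {ι : Type*} (τ : ι → ℕ × ℕ) : Type _ :=
  ∀ c : Option ι, Jet n (rank τ c).1 (rank τ c).2

/-- The action of the linear group on the arguments of a Lagrangian. -/
def jetAct {n : ℕ} {ι : Type*} {τ : ι → ℕ × ℕ} (A : Matrix.GeneralLinearGroup (Fin n) ℝ)
    (z : JetSpace n τ) : JetSpace n τ :=
  fun c =>
    (tensorAct (A : Matrix (Fin n) (Fin n) ℝ) (A⁻¹ : Matrix.GeneralLinearGroup (Fin n) ℝ) (z c).1,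
      tensorAct (A : Matrix (Fin n) (Fin n) ℝ) (A⁻¹ : Matrix.GeneralLinearGroup (Fin n) ℝ)
        (z c).2.1,
      tensorAct (A : Matrix (Fin n) (Fin n) ℝ) (A⁻¹ : Matrix.GeneralLinearGroup (Fin n) ℝ)
        (z c).2.2)

/-- A Lagrangian invariant `L(g, ∇g, ∇∇g, V, ∇V, ∇∇V)`: a smooth scalar function of its arguments.
It need not be defined for all values of the arguments (it may contain `g⁻¹`, for example). -/
structure LagrangianInvariant (n : ℕ) {ι : Type*} [Fintype ι] (τ : ι → ℕ × ℕ) where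
  dom : Set (JetSpace n τ)
  isOpen_dom : IsOpen dom
  toFun : JetSpace n τ → ℝ
  smooth : ContDiffOn ℝ ∞ toFun dom
  dom_invariant : ∀ A : Matrix.GeneralLinearGroup (Fin n) ℝ, ∀ z ∈ dom, jetAct A z ∈ dom
  invariant : ∀ A : Matrix.GeneralLinearGroup (Fin n) ℝ, ∀ z ∈ dom, toFun (jetAct A z) = toFun z

section Jets

variable {n : ℕ} {M : Type*} [TopologicalSpace M] [ChartedSpace (EuclideanSpace ℝ (Fin n)) M]

/-- The covariant derivative `V^A_{B;k}`: `Γ` on contravariant indices, `P` on covariant ones. -/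
def covD1 (X : LbarSpace n M) {r s : ℕ} (V : TensorField n M r s)
    (e : OpenPartialHomeomorph M (Coord n)) : Coord n → Ten n r (s + 1) :=
  covD (X.Γ.coeff e) (fun _ => X.P.coeff e) (V.comp e)

/-- The second covariant derivative `V^A_{B;k;l}`.  The index `k` is the slot of the vector `ξ`
in `∇_ξ V = ξ^k V_{;k}`, hence it is differentiated with the dual of `Γ`. -/
def covD2 (X : LbarSpace n M) {r s : ℕ} (V : TensorField n M r s)
    (e : OpenPartialHomeomorph M (Coord n)) : Coord n → Ten n r (s + 2) :=
  covD (X.Γ.coeff e)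
    (Fin.snoc (α := fun _ => Coord n → Conn n) (fun _ => X.P.coeff e) (dualConn (X.Γ.coeff e)))
    (covD1 X V e)

/-- The values `V^A_{B̄}`, `V^A_{B̄;k}`, `V^A_{B̄;k;l}` at a point, where every covariant index is
contracted with contravariant ones by means of the contraction operator, `p_{j̄} = f^i_j p_i`. -/
def jetOf (X : LbarSpace n M) {r s : ℕ} (V : TensorField n M r s)
    (e : OpenPartialHomeomorph M (Coord n)) (x : Coord n) : Jet n r s :=
  (contractLower (fun _ => X.fMat e x) (V.comp e x),
    contractLower (Fin.snoc (α := fun _ => Matrix (Fin n) (Fin n) ℝ) (fun _ => X.fMat e x) 1)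
      (covD1 X V e x),
    contractLower
      (Fin.snoc (α := fun _ => Matrix (Fin n) (Fin n) ℝ)
        (Fin.snoc (α := fun _ => Matrix (Fin n) (Fin n) ℝ) (fun _ => X.fMat e x) 1) 1)
      (covD2 X V e x))

/-- The metric together with the non-metric fields, as one family. -/
def allFields (X : LbarSpace n M) {ι : Type*} {τ : ι → ℕ × ℕ}
    (V : ∀ a, TensorField n M (τ a).1 (τ a).2) :
    ∀ c : Option ι, TensorField n M (rank τ c).1 (rank τ c).2
  | none => X.g
  | some a => V a

end Jets

/-- A Lagrangian system over an `(L̄_n, g)`-space: finitely many tensor fields `V_a` and a Lagrangian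
invariant of the metric, the fields and their first and second covariant derivatives. -/
structure LagrangianSystem (n : ℕ) (M : Type*) [TopologicalSpace M]
    [ChartedSpace (EuclideanSpace ℝ (Fin n)) M] {ι : Type*} [Fintype ι] (τ : ι → ℕ × ℕ) where
  X : LbarSpace n M
  V : ∀ a, TensorField n M (τ a).1 (τ a).2
  lagr : LagrangianInvariant n τ
  jet_mem : ∀ e ∈ atlas (EuclideanSpace ℝ (Fin n)) M, ∀ x ∈ e.target,
    (fun c => jetOf X (allFields X V c) e x) ∈ lagr.dom

namespace LagrangianSystem

variable {n : ℕ} {M : Type*} [TopologicalSpace M] [ChartedSpace (EuclideanSpace ℝ (Fin n)) M]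
  {ι : Type*} [Fintype ι] {τ : ι → ℕ × ℕ}

/-- The arguments of the Lagrangian invariant at a point. -/
def jet (Λ : LagrangianSystem n M τ) (e : OpenPartialHomeomorph M (Coord n)) (x : Coord n) :
    JetSpace n τ :=
  fun c => jetOf Λ.X (allFields Λ.X Λ.V c) e x

/-- The Lagrangian invariant `L` as a function of the coordinates. -/
def L (Λ : LagrangianSystem n M τ) (e : OpenPartialHomeomorph M (Coord n)) (x : Coord n) : ℝ :=
  Λ.lagr.toFun (Λ.jet e x)

/-- `∂L/∂V^A_B`; the upper index `A` of `V` becomes a lower one and conversely. -/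
def mom0 (Λ : LagrangianSystem n M τ) (e : OpenPartialHomeomorph M (Coord n)) (c : Option ι)
    (x : Coord n) : Ten n (rank τ c).2 (rank τ c).1 :=
  open Classical in
  fun B A => fderiv ℝ Λ.lagr.toFun (Λ.jet e x) (Pi.single c (Pi.single A (Pi.single B 1), 0, 0))

/-- `∂L/∂V^A_{B;k}`. -/
def mom1 (Λ : LagrangianSystem n M τ) (e : OpenPartialHomeomorph M (Coord n)) (c : Option ι)
    (x : Coord n) : Ten n ((rank τ c).2 + 1) (rank τ c).1 :=
  open Classical in
  fun B A => fderiv ℝ Λ.lagr.toFun (Λ.jet e x) (Pi.single c (0, Pi.single A (Pi.single B 1), 0))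

/-- `∂L/∂V^A_{B;k;l}`. -/
def mom2 (Λ : LagrangianSystem n M τ) (e : OpenPartialHomeomorph M (Coord n)) (c : Option ι)
    (x : Coord n) : Ten n ((rank τ c).2 + 2) (rank τ c).1 :=
  open Classical in
  fun B A => fderiv ℝ Λ.lagr.toFun (Λ.jet e x) (Pi.single c (0, 0, Pi.single A (Pi.single B 1)))

/-- The covariant canonical momentum `∂L/∂V^A_{B;k} - (∂L/∂V^A_{B;k;l})_{;l}`. -/
def canMom (Λ : LagrangianSystem n M τ) (e : OpenPartialHomeomorph M (Coord n)) (c : Option ι)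
    (x : Coord n) : Ten n ((rank τ c).2 + 1) (rank τ c).1 :=
  fun B A => Λ.mom1 e c x B A - divLast (Λ.X.Γ.coeff e) (Λ.mom2 e c) x B A

/-- The covariant Euler–Lagrange derivative
`δL/δV^A_B = ∂L/∂V^A_B - (∂L/∂V^A_{B;k})_{;k} + (∂L/∂V^A_{B;k;l})_{;l;k}`. -/
def eulerLagrange (Λ : LagrangianSystem n M τ) (e : OpenPartialHomeomorph M (Coord n))
    (c : Option ι) (x : Coord n) : Ten n (rank τ c).2 (rank τ c).1 :=
  fun B A => Λ.mom0 e c x B A - divLast (Λ.X.Γ.coeff e) (Λ.mom1 e c) x B A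
    + divLast (Λ.X.Γ.coeff e) (divLast (Λ.X.Γ.coeff e) (Λ.mom2 e c)) x B A

/-- The contribution of one field to the variational energy-momentum tensor of Euler–Lagrange,
`- (δL/δV^A_B) S_α^β V^A_B`; the entry is `Q_α^β`. -/
def variationalPart (Λ : LagrangianSystem n M τ) (e : OpenPartialHomeomorph M (Coord n))
    (c : Option ι) (x : Coord n) (α β : Fin n) : ℝ :=
  - ∑ A, ∑ B, Λ.eulerLagrange e c x B A * lieGen α β (Λ.jet e x c).1 A B

/-- The variational energy-momentum tensor of Euler–Lagrange `Q = _gQ + _vQ`, as `Q_α^β`. -/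
def Q (Λ : LagrangianSystem n M τ) (e : OpenPartialHomeomorph M (Coord n)) (x : Coord n)
    (α β : Fin n) : ℝ :=
  Λ.variationalPart e none x α β + ∑ a : ι, Λ.variationalPart e (some a) x α β

/-- The canonical energy-momentum tensor
`t_α^β = ∑ (∂L/∂V_{;β} - (∂L/∂V_{;β;l})_{;l}) V_{;α} + ∑ (∂L/∂V_{;k;β}) V_{;k;α} - L δ_α^β`,
summed over all field variables. -/
def canonical (Λ : LagrangianSystem n M τ) (e : OpenPartialHomeomorph M (Coord n)) (x : Coord n)
    (α β : Fin n) : ℝ :=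
  (∑ c : Option ι, ∑ A, ∑ B : Fin (rank τ c).2 → Fin n,
    (Λ.canMom e c x (Fin.snoc (α := fun _ => Fin n) B β) A
        * (Λ.jet e x c).2.1 A (Fin.snoc (α := fun _ => Fin n) B α)
      + ∑ k, Λ.mom2 e c x
          (Fin.snoc (α := fun _ => Fin n) (Fin.snoc (α := fun _ => Fin n) B k) β) A
        * (Λ.jet e x c).2.2 A
          (Fin.snoc (α := fun _ => Fin n) (Fin.snoc (α := fun _ => Fin n) B k) α)))
    - if α = β then Λ.L e x else 0

/-- The spin-type tensor `U_α^{βγ}`: the coefficient of `ξ^α_{;β}` in the current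
`(∂L/∂V_{;γ} - (∂L/∂V_{;γ;l})_{;l}) £_ξV + (∂L/∂V_{;k;γ}) (£_ξV)_{;k}`, summed over all field
variables; torsion terms, which belong to the coefficient of `ξ^α`, do not enter. -/
def spin (Λ : LagrangianSystem n M τ) (e : OpenPartialHomeomorph M (Coord n)) (x : Coord n)
    (α β γ : Fin n) : ℝ :=
  ∑ c : Option ι, ∑ A, ∑ B : Fin (rank τ c).2 → Fin n,
    (Λ.canMom e c x (Fin.snoc (α := fun _ => Fin n) B γ) A * lieGen α β (Λ.jet e x c).1 A B
      + (∑ k, Λ.mom2 e c x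
            (Fin.snoc (α := fun _ => Fin n) (Fin.snoc (α := fun _ => Fin n) B k) γ) A
          * lieGen α β
            (fun A' B' => (Λ.jet e x c).2.1 A' (Fin.snoc (α := fun _ => Fin n) B' k)) A B)
      + Λ.mom2 e c x
            (Fin.snoc (α := fun _ => Fin n) (Fin.snoc (α := fun _ => Fin n) B β) γ) A
          * (Λ.jet e x c).2.1 A (Fin.snoc (α := fun _ => Fin n) B α))

/-- `U^{αβγ} = g^{αδ} U_δ^{βγ}`. -/
def spinUp (Λ : LagrangianSystem n M τ) (e : OpenPartialHomeomorph M (Coord n)) (x : Coord n)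
    (α β γ : Fin n) : ℝ :=
  ∑ δ, Λ.X.gInv e x α δ * Λ.spin e x δ β γ

/-- The spin tensor `U^{[αβ]γ}`. -/
def spinAnti (Λ : LagrangianSystem n M τ) (e : OpenPartialHomeomorph M (Coord n)) (x : Coord n)
    (α β γ : Fin n) : ℝ :=
  (Λ.spinUp e x α β γ - Λ.spinUp e x β α γ) / 2

/-- The Belinfante combination `U^{[αβ]γ} + U^{[γα]β} + U^{[γβ]α}`: it is antisymmetric in `β, γ`
and its part antisymmetric in `α, β` is the spin tensor. -/
def belinfante (Λ : LagrangianSystem n M τ) (e : OpenPartialHomeomorph M (Coord n)) (x : Coord n)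
    (α β γ : Fin n) : ℝ :=
  Λ.spinAnti e x α β γ + Λ.spinAnti e x γ α β + Λ.spinAnti e x γ β α

/-- The rest `Ψ^{αβγ}` of `U^{αβγ}`, symmetric in `α, β`. -/
def spinSym (Λ : LagrangianSystem n M τ) (e : OpenPartialHomeomorph M (Coord n)) (x : Coord n)
    (α β γ : Fin n) : ℝ :=
  Λ.spinUp e x α β γ - Λ.belinfante e x α β γ

/-- The viscosity tensor `T_α^β = - g_{ᾱδ̄} Ψ^{δβγ}_{;γ}` (with `T^{αβ} = T^{βα}`). -/
def viscosity (Λ : LagrangianSystem n M τ) (e : OpenPartialHomeomorph M (Coord n)) (x : Coord n)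
    (α β : Fin n) : ℝ :=
  - ∑ δ, Λ.X.gBar e x α δ *
    divLast (Λ.X.Γ.coeff e)
      (fun y (C : Fin 3 → Fin n) (_ : Fin 0 → Fin n) => Λ.spinSym e y (C 0) (C 1) (C 2)) x
      ![δ, β] ![]

/-- The symmetric energy-momentum tensor of Belinfante `_sT = T - L·Kr`, as `_sT_α^β`. -/
def sT (Λ : LagrangianSystem n M τ) (e : OpenPartialHomeomorph M (Coord n)) (x : Coord n)
    (α β : Fin n) : ℝ :=
  Λ.viscosity e x α β - if α = β then Λ.L e x else 0

/-- `K_α^β = - g_{ᾱδ̄;γ} Ψ^{δβγ}`, which vanishes if the metric is covariantly constant. -/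
def nonmetricity (Λ : LagrangianSystem n M τ) (e : OpenPartialHomeomorph M (Coord n))
    (x : Coord n) (α β : Fin n) : ℝ :=
  - ∑ δ, ∑ γ, (jetOf Λ.X Λ.X.g e x).2.1 ![] ![α, δ, γ] * Λ.spinSym e x δ β γ

/-- The Belinfante superpotential `W_α^{βγ} = - g_{ᾱδ̄} B^{δβγ} = - W_α^{γβ}`, where `B` is the
Belinfante combination. -/
def superpotential (Λ : LagrangianSystem n M τ) (e : OpenPartialHomeomorph M (Coord n))
    (x : Coord n) (α β γ : Fin n) : ℝ :=
  - ∑ δ, Λ.X.gBar e x α δ * Λ.belinfante e x δ β γ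

/-- The generalized canonical energy-momentum tensor `θ_α^β = t_α^β - K_α^β - W_α^{βγ}_{;γ}`. -/
def theta (Λ : LagrangianSystem n M τ) (e : OpenPartialHomeomorph M (Coord n)) (x : Coord n)
    (α β : Fin n) : ℝ :=
  Λ.canonical e x α β - Λ.nonmetricity e x α β
    - divLast (Λ.X.Γ.coeff e)
        (fun y (C : Fin 2 → Fin n) (D : Fin 1 → Fin n) => Λ.superpotential e y (D 0) (C 0) (C 1)) x
        ![β] ![α]

/-- The rest mass density `ρ_θ` at the point `p`, computed in the chart `e`. -/
def rhoThetaIn (Λ : LagrangianSystem n M τ) (u : TensorField n M 1 0)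
    (e : OpenPartialHomeomorph M (Coord n)) (p : M) : ℝ :=
  Λ.X.uProjection u e (e p) (Λ.theta e (e p))

/-- The rest mass density `ρ_T` at the point `p`, computed in the chart `e`. -/
def rhoTIn (Λ : LagrangianSystem n M τ) (u : TensorField n M 1 0)
    (e : OpenPartialHomeomorph M (Coord n)) (p : M) : ℝ :=
  Λ.X.uProjection u e (e p) (Λ.sT e (e p))

/-- The rest mass density `ρ_Q = -(1/e²) [g(u)](Q)(u)` at the point `p`, computed in the
chart `e`. -/
def rhoQIn (Λ : LagrangianSystem n M τ) (u : TensorField n M 1 0)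
    (e : OpenPartialHomeomorph M (Coord n)) (p : M) : ℝ :=
  - Λ.X.uProjection u e (e p) (Λ.Q e (e p))

/-- The rest mass density `ρ_θ` as a function on the manifold. -/
def rhoTheta (Λ : LagrangianSystem n M τ) (u : TensorField n M 1 0) (p : M) : ℝ :=
  Λ.rhoThetaIn u (chartAt (EuclideanSpace ℝ (Fin n)) p) p

/-- The rest mass density `ρ_T` as a function on the manifold. -/
def rhoT (Λ : LagrangianSystem n M τ) (u : TensorField n M 1 0) (p : M) : ℝ :=
  Λ.rhoTIn u (chartAt (EuclideanSpace ℝ (Fin n)) p) p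

/-- The rest mass density `ρ_Q` as a function on the manifold. -/
def rhoQ (Λ : LagrangianSystem n M τ) (u : TensorField n M 1 0) (p : M) : ℝ :=
  Λ.rhoQIn u (chartAt (EuclideanSpace ℝ (Fin n)) p) p

end LagrangianSystem

end LbarGeometry

end

open scoped Manifold ContDiff

noncomputable section

namespace LbarGeometry

/-! Index combinatorics -/

/-! The three tensors satisfy `θ - sT = Q` componentwise, in every chart and at every point. This is
a covariant Noether identity. The projection along `u` is linear in the tensor and `ρ_Q` carries a
minus sign, so `ρ_θ - ρ_T = -ρ_Q`, and both equivalences follow.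

The identity has two halves. The first, `theta_sub_sT_eq`, is bookkeeping. Since `Ψ = U - B`,
lowering the first index gives `gΨ = U + W`. The Leibniz rule then gives `div U + div W = g_{;γ}Ψ +
gΨ_{;γ}`, whose right side is minus the sum of `K` and the viscosity tensor. Substitution into the
definitions leaves `θ - sT = t + L·δ + div U`.

The second half, `canonical_add_mixedDiv_spin`, says that this equals `Q`. For each field,
`noether_identity` expands `div U` by the Leibniz rule. Together with that field's part of `t + L·δ`
it becomes minus the Euler–Lagrange expression paired with `Sφ`, plus that field's part of the
derivative of `L` along the infinitesimal `GL(n)` action. Summed over all fields, the latter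
vanishes by invariance of `L` (`fderiv_lieJet`). Covariant derivatives are never commuted, so
neither curvature nor torsion appears.

Two devices make the expansion manageable. First, `S_α^β` is a representation of `gl(n)`, and the
covariant derivative is `∂_k - Γ^a_{bk} S_a^b`; every cancellation of connection terms reduces to
the commutation relations, the invariance of the complete contraction, and the rules for freezing an
index. Second, `f` intertwines `P` with `Γ`, so by `nabla_contractLower` the barred jets are
iterated `Γ`-derivatives of the barred fields, and `P` and `f` disappear from the computation. -/

theorem sum_update_swap {n s : ℕ} (m : Fin s) (h : (Fin s → Fin n) → Fin n → ℝ) :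
    ∑ D, ∑ l, h D l = ∑ D : Fin s → Fin n, ∑ l, h (Function.update D m l) (D m) := by
  rw [← Fintype.sum_prod_type', ← Fintype.sum_prod_type']
  -- Exchanging `D m` with the extra variable `l` is an involution.
  refine Finset.sum_nbij' (fun p => (Function.update p.1 m p.2, p.1 m))
    (fun p => (Function.update p.1 m p.2, p.1 m)) ?_ ?_ ?_ ?_ ?_ <;> simp

theorem sum_snoc {n s : ℕ} (h : (Fin (s + 1) → Fin n) → ℝ) :
    ∑ B, h B = ∑ B : Fin s → Fin n, ∑ k, h (Fin.snoc (α := fun _ => Fin n) B k) := by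
  rw [← (Fin.snocEquiv (fun _ : Fin (s + 1) => Fin n)).sum_comp, Fintype.sum_prod_type,
    Finset.sum_comm]
  rfl

/-- The part of `lieGen` acting on one group of indices. -/
def indexShift {n s : ℕ} (α β : Fin n) (F : (Fin s → Fin n) → ℝ) (B : Fin s → Fin n) : ℝ :=
  ∑ m, if B m = β then F (Function.update B m α) else 0

/-- Upper indices carry the dual representation: the same operator with `α`, `β` exchanged and a
minus sign. Each algebraic fact about `lieGen` is thus proved once, for a single group of indices.
-/
theorem lieGen_eq_indexShift {n r s : ℕ} (α β : Fin n) (T : Ten n r s) (A : Fin r → Fin n)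
    (B : Fin s → Fin n) :
    lieGen α β T A B = indexShift α β (T A) B - indexShift β α (fun A' => T A' B) A := rfl

/-- Adjointness: the transpose of the elementary matrix with indices `α, β` is the one with `β, α`.
-/
theorem sum_indexShift_mul {n s : ℕ} (α β : Fin n) (F G : (Fin s → Fin n) → ℝ) :
    ∑ B, indexShift α β F B * G B = ∑ B, F B * indexShift β α G B := by
  simp only [indexShift, Finset.sum_mul, Finset.mul_sum]
  rw [Finset.sum_comm, Finset.sum_comm (s := Finset.univ (α := Fin s → Fin n))]
  refine Finset.sum_congr rfl fun m _ => ?_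
  -- A dummy value `l` is summed on both sides so that the exchange of `B m` with `l` carries one
  -- expression to the other.
  have h1 : ∀ B : Fin s → Fin n, (if B m = β then F (Function.update B m α) else 0) * G B
      = ∑ l, if B m = β ∧ l = α then F (Function.update B m l) * G B else 0 := by
    intro B
    by_cases h : B m = β <;> simp [h]
  have h2 : ∀ B : Fin s → Fin n, F B * (if B m = α then G (Function.update B m β) else 0)
      = ∑ l, if l = β ∧ B m = α then F B * G (Function.update B m l) else 0 := by
    intro B
    by_cases h : B m = α <;> simp [h]
  simp only [h1, h2]
  rw [sum_update_swap m]
  simp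

theorem indexShift_add {n s : ℕ} (α β : Fin n) (F G : (Fin s → Fin n) → ℝ) (B : Fin s → Fin n) :
    indexShift α β (fun B => F B + G B) B = indexShift α β F B + indexShift α β G B := by
  simp only [indexShift, ← Finset.sum_add_distrib]
  refine Finset.sum_congr rfl fun m _ => ?_
  split_ifs <;> simp

theorem indexShift_sub {n s : ℕ} (α β : Fin n) (F G : (Fin s → Fin n) → ℝ) (B : Fin s → Fin n) :
    indexShift α β (fun B => F B - G B) B = indexShift α β F B - indexShift α β G B := by
  simp only [indexShift, ← Finset.sum_sub_distrib]
  refine Finset.sum_congr rfl fun m _ => ?_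
  split_ifs <;> simp

theorem indexShift_const_mul {n s : ℕ} (α β : Fin n) (c : ℝ) (F : (Fin s → Fin n) → ℝ)
    (B : Fin s → Fin n) :
    indexShift α β (fun B => c * F B) B = c * indexShift α β F B := by
  simp only [indexShift, Finset.mul_sum]
  refine Finset.sum_congr rfl fun m _ => ?_
  split_ifs <;> simp

/-- These are the relations of elementary matrices. Operators in different slots commute, so only
the terms with both in the same slot contribute to the commutator. -/
theorem indexShift_commutator {n s : ℕ} (μ ν α β : Fin n) (F : (Fin s → Fin n) → ℝ)
    (B : Fin s → Fin n) :
    indexShift μ ν (indexShift α β F) B - indexShift α β (indexShift μ ν F) B =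
      (if μ = β then indexShift α ν F B else 0) - if α = ν then indexShift μ β F B else 0 := by
  have e : ∀ μ ν α β : Fin n, indexShift μ ν (indexShift α β F) B =
      ∑ m, ∑ m', if B m = ν ∧ Function.update B m μ m' = β then
        F (Function.update (Function.update B m μ) m' α) else 0 := by
    intro μ ν α β
    refine Finset.sum_congr rfl fun m _ => ?_
    by_cases h : B m = ν <;> simp [h, indexShift]
  rw [e, e, Finset.sum_comm (s := Finset.univ (α := Fin s))
    (f := fun m m' => if B m = β ∧ Function.update B m α m' = ν then
        F (Function.update (Function.update B m α) m' μ) else 0), ← Finset.sum_sub_distrib]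
  -- After the swap of summations, `m` is the slot of the `(μ, ν)` operator in both products and
  -- `m'` that of the `(α, β)` operator; the off-diagonal terms cancel pairwise.
  have key : ∀ m : Fin s,
      ((∑ m', if B m = ν ∧ Function.update B m μ m' = β then
        F (Function.update (Function.update B m μ) m' α) else 0)
      - ∑ m', if B m' = β ∧ Function.update B m' α m = ν then
        F (Function.update (Function.update B m' α) m μ) else 0)
      = (if μ = β then (if B m = ν then F (Function.update B m α) else 0) else 0)
        - if α = ν then (if B m = β then F (Function.update B m μ) else 0) else 0 := by
    intro m
    rw [← Finset.sum_sub_distrib, Finset.sum_eq_single m]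
    · simp only [Function.update_self, Function.update_idem]
      by_cases h1 : μ = β <;> by_cases h2 : α = ν <;> by_cases h3 : B m = ν <;>
        by_cases h4 : B m = β <;> simp [h1, h2, h3, h4]
    · intro m' _ hm
      rw [Function.update_of_ne hm, Function.update_of_ne hm.symm, Function.update_comm hm,
        sub_eq_zero]
      simp only [and_comm]
    · simp
  rw [Finset.sum_congr rfl fun m _ => key m, Finset.sum_sub_distrib]
  by_cases h1 : μ = β <;> by_cases h2 : α = ν <;> simp [h1, h2, indexShift]

theorem indexShift_comm {n r s : ℕ} (μ ν α β : Fin n) (T : Ten n r s) (A : Fin r → Fin n)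
    (B : Fin s → Fin n) :
    indexShift μ ν (fun B' => indexShift α β (fun A' => T A' B') A) B =
      indexShift α β (fun A' => indexShift μ ν (T A') B) A := by
  have h1 : ∀ (m : Fin s), (if B m = ν then
      ∑ m', (if A m' = β then T (Function.update A m' α) (Function.update B m μ) else 0) else 0) =
      ∑ m', if B m = ν then
        (if A m' = β then T (Function.update A m' α) (Function.update B m μ) else 0) else 0 := by
    intro m; split_ifs <;> simp
  have h2 : ∀ (m' : Fin r), (if A m' = β then
      ∑ m, (if B m = ν then T (Function.update A m' α) (Function.update B m μ) else 0) else 0) =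
      ∑ m, if A m' = β then
        (if B m = ν then T (Function.update A m' α) (Function.update B m μ) else 0) else 0 := by
    intro m; split_ifs <;> simp
  simp only [indexShift, h1, h2]
  rw [Finset.sum_comm]
  refine Finset.sum_congr rfl fun m' _ => Finset.sum_congr rfl fun m _ => ?_
  split_ifs <;> rfl

theorem indexShift_snoc {n s : ℕ} (α β : Fin n) (F : (Fin (s + 1) → Fin n) → ℝ)
    (B : Fin s → Fin n) (k : Fin n) :
    indexShift α β F (Fin.snoc (α := fun _ => Fin n) B k) =
      indexShift α β (fun B' => F (Fin.snoc (α := fun _ => Fin n) B' k)) B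
        + if k = β then F (Fin.snoc (α := fun _ => Fin n) B α) else 0 := by
  simp only [indexShift, Fin.sum_univ_castSucc, Fin.snoc_castSucc, Fin.snoc_last,
    Fin.update_snoc_last, Fin.snoc_update]

/-! The algebra of `lieGen` -/

/-- The complete contraction of a tensor with one of the dual rank. -/
def pair {n r s : ℕ} (P : Ten n s r) (T : Ten n r s) : ℝ :=
  ∑ A, ∑ B, P B A * T A B

/-- The complete contraction is a `gl(n)`-invariant, by adjointness in each group of indices. -/
theorem pair_lieGen {n r s : ℕ} (α β : Fin n) (P : Ten n s r) (T : Ten n r s) :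
    pair (lieGen α β P) T + pair P (lieGen α β T) = 0 := by
  have h1 : ∑ A, ∑ B, indexShift α β (P B) A * T A B =
      ∑ A, ∑ B, P B A * indexShift β α (fun A' => T A' B) A := by
    rw [Finset.sum_comm, Finset.sum_comm (f := fun A B => P B A * _)]
    exact Finset.sum_congr rfl fun B _ => sum_indexShift_mul α β (P B) fun A => T A B
  have h2 : ∑ A, ∑ B, indexShift β α (fun B' => P B' A) B * T A B =
      ∑ A, ∑ B, P B A * indexShift α β (T A) B :=
    Finset.sum_congr rfl fun A _ => sum_indexShift_mul β α (fun B => P B A) (T A)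
  simp only [pair, lieGen_eq_indexShift, sub_mul, mul_sub, Finset.sum_sub_distrib, h1, h2]
  ring

theorem lieGen_add {n r s : ℕ} (α β : Fin n) (T T' : Ten n r s) :
    lieGen α β (T + T') = lieGen α β T + lieGen α β T' := by
  funext A B
  simp only [Pi.add_apply, lieGen_eq_indexShift]
  have h1 := indexShift_add α β (T A) (T' A) B
  have h2 := indexShift_add β α (fun A => T A B) (fun A => T' A B) A
  have e : T A + T' A = fun B => T A B + T' A B := rfl
  rw [e, h1, h2]; ring

theorem lieGen_smul {n r s : ℕ} (α β : Fin n) (c : ℝ) (T : Ten n r s) :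
    lieGen α β (c • T) = c • lieGen α β T := by
  funext A B
  simp only [Pi.smul_apply, lieGen_eq_indexShift, smul_eq_mul]
  have h1 := indexShift_const_mul α β c (T A) B
  have h2 := indexShift_const_mul β α c (fun A => T A B) A
  have e : c • T A = fun B => c * T A B := rfl
  rw [e, h1, h2]; ring

/-- `lieGen` as a linear map. -/
def lieGenLin {n r s : ℕ} (α β : Fin n) : Ten n r s →ₗ[ℝ] Ten n r s where
  toFun := lieGen α β
  map_add' := lieGen_add α β
  map_smul' := lieGen_smul α β

theorem lieGen_sub {n r s : ℕ} (α β : Fin n) (T T' : Ten n r s) :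
    lieGen α β (T - T') = lieGen α β T - lieGen α β T' :=
  map_sub (lieGenLin α β) T T'

theorem lieGen_sum {n r s : ℕ} {κ : Type*} (S : Finset κ) (α β : Fin n) (T : κ → Ten n r s) :
    lieGen α β (∑ i ∈ S, T i) = ∑ i ∈ S, lieGen α β (T i) :=
  map_sum (lieGenLin α β) T S

/-- The commutator splits into a lower-lower and an upper-upper part, both given by
`indexShift_commutator`; the mixed parts cancel because they act in different slots. -/
theorem lieGen_commutator {n r s : ℕ} (μ ν α β : Fin n) (T : Ten n r s) :
    lieGen μ ν (lieGen α β T) = lieGen α β (lieGen μ ν T)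
      + (if μ = β then lieGen α ν T else 0) - if α = ν then lieGen μ β T else 0 := by
  funext A B
  have e1 : ∀ α β : Fin n, lieGen α β T A =
      fun B => indexShift α β (T A) B - indexShift β α (fun A' => T A' B) A := fun _ _ => rfl
  have c1 := indexShift_commutator μ ν α β (T A) B
  have c2 := indexShift_commutator ν μ β α (fun A => T A B) A
  have c3 := indexShift_comm μ ν β α T A B
  have c4 := indexShift_comm α β ν μ T A B
  have main : lieGen μ ν (lieGen α β T) A B - lieGen α β (lieGen μ ν T) A B =
      (if μ = β then lieGen α ν T A B else 0) - if α = ν then lieGen μ β T A B else 0 := by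
    simp only [lieGen_eq_indexShift μ ν (lieGen α β T), lieGen_eq_indexShift α β (lieGen μ ν T)]
    simp only [e1, lieGen_eq_indexShift, indexShift_sub]
    rw [c3, c4]
    by_cases h1 : μ = β <;> by_cases h2 : α = ν <;>
      simp only [h1, h2, eq_comm (a := β) (b := μ), eq_comm (a := ν) (b := α), if_true,
        if_false] at c1 c2 ⊢ <;> linarith
  have h3 : (if μ = β then lieGen α ν T else 0) A B = if μ = β then lieGen α ν T A B else 0 := by
    split_ifs <;> rfl
  have h4 : (if α = ν then lieGen μ β T else 0) A B = if α = ν then lieGen μ β T A B else 0 := by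
    split_ifs <;> rfl
  simp only [Pi.add_apply, Pi.sub_apply, h3, h4]
  linarith

/-- The components of a tensor with a fixed value of the last lower index. -/
def lowerSlice {n r s : ℕ} (T : Ten n r (s + 1)) (k : Fin n) : Ten n r s :=
  fun A B => T A (Fin.snoc (α := fun _ => Fin n) B k)

/-- The components of a tensor with a fixed value of the last upper index. -/
def upperSlice {n r s : ℕ} (T : Ten n (r + 1) s) (k : Fin n) : Ten n r s :=
  fun A B => T (Fin.snoc (α := fun _ => Fin n) A k) B

/-- Freezing an index is not equivariant. The correction is the action on the frozen slot, and it is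
the source of every bare `φ_{;α}` term in the Noether identity. -/
theorem lowerSlice_lieGen {n r s : ℕ} (α β : Fin n) (T : Ten n r (s + 1)) (k : Fin n) :
    lowerSlice (lieGen α β T) k =
      lieGen α β (lowerSlice T k) + if k = β then lowerSlice T α else 0 := by
  funext A B
  have h3 : (if k = β then lowerSlice T α else 0) A B = if k = β then lowerSlice T α A B else 0 := by
    split_ifs <;> rfl
  simp only [Pi.add_apply, h3]
  simp only [lowerSlice, lieGen_eq_indexShift, indexShift_snoc]
  ring!

theorem upperSlice_lieGen {n r s : ℕ} (α β : Fin n) (T : Ten n (r + 1) s) (k : Fin n) :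
    upperSlice (lieGen α β T) k =
      lieGen α β (upperSlice T k) - if k = α then upperSlice T β else 0 := by
  funext A B
  have h3 : (if k = α then upperSlice T β else 0) A B = if k = α then upperSlice T β A B else 0 := by
    split_ifs <;> rfl
  simp only [Pi.sub_apply, h3]
  simp only [upperSlice, lieGen_eq_indexShift, indexShift_snoc]
  ring!

/-! Linearity of the complete contraction -/

/-- `pair` as a bilinear map. -/
def pairLin (n r s : ℕ) : Ten n s r →ₗ[ℝ] Ten n r s →ₗ[ℝ] ℝ :=
  LinearMap.mk₂ ℝ pair
    (fun P P' T => by simp [pair, add_mul, Finset.sum_add_distrib])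
    (fun c P T => by simp [pair, mul_assoc, Finset.mul_sum])
    (fun P T T' => by simp [pair, mul_add, Finset.sum_add_distrib])
    (fun c P T => by simp [pair, mul_left_comm, Finset.mul_sum])

theorem pairLin_apply {n r s : ℕ} (P : Ten n s r) (T : Ten n r s) : pairLin n r s P T = pair P T :=
  rfl

section
variable {n r s : ℕ} {κ : Type*}

theorem pair_add_left (P P' : Ten n s r) (T : Ten n r s) :
    pair (P + P') T = pair P T + pair P' T := by simp [← pairLin_apply]

theorem pair_add_right (P : Ten n s r) (T T' : Ten n r s) :
    pair P (T + T') = pair P T + pair P T' := by simp [← pairLin_apply]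

theorem pair_sub_left (P P' : Ten n s r) (T : Ten n r s) :
    pair (P - P') T = pair P T - pair P' T := by simp [← pairLin_apply]

theorem pair_sub_right (P : Ten n s r) (T T' : Ten n r s) :
    pair P (T - T') = pair P T - pair P T' := by simp [← pairLin_apply]

theorem pair_smul_left (c : ℝ) (P : Ten n s r) (T : Ten n r s) :
    pair (c • P) T = c * pair P T := by simp [← pairLin_apply]

theorem pair_smul_right (c : ℝ) (P : Ten n s r) (T : Ten n r s) :
    pair P (c • T) = c * pair P T := by simp [← pairLin_apply]

theorem pair_sum_left (S : Finset κ) (P : κ → Ten n s r) (T : Ten n r s) :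
    pair (∑ i ∈ S, P i) T = ∑ i ∈ S, pair (P i) T := by simp [← pairLin_apply]

theorem pair_sum_right (S : Finset κ) (P : Ten n s r) (T : κ → Ten n r s) :
    pair P (∑ i ∈ S, T i) = ∑ i ∈ S, pair P (T i) := by simp [← pairLin_apply]

end

/-! Partial derivatives -/

section
variable {n r s : ℕ} {κ : Type*} {x : Coord n} (k : Fin n)

theorem partialD_add {F G : Coord n → ℝ} (hF : DifferentiableAt ℝ F x)
    (hG : DifferentiableAt ℝ G x) :
    partialD k (fun y => F y + G y) x = partialD k F x + partialD k G x := by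
  simp [partialD, fderiv_fun_add hF hG]

theorem partialD_mul {F G : Coord n → ℝ} (hF : DifferentiableAt ℝ F x)
    (hG : DifferentiableAt ℝ G x) :
    partialD k (fun y => F y * G y) x = partialD k F x * G x + F x * partialD k G x := by
  simp [partialD, fderiv_fun_mul hF hG]; ring

theorem partialD_sum {S : Finset κ} {F : κ → Coord n → ℝ}
    (hF : ∀ i ∈ S, DifferentiableAt ℝ (F i) x) :
    partialD k (fun y => ∑ i ∈ S, F i y) x = ∑ i ∈ S, partialD k (F i) x := by
  simp [partialD, fderiv_fun_sum hF]

/-- The partial derivatives of the components of a tensor. -/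
def tenD (k : Fin n) (T : Coord n → Ten n r s) (x : Coord n) : Ten n r s :=
  fun A B => partialD k (fun y => T y A B) x

theorem differentiableAt_ten_iff {T : Coord n → Ten n r s} :
    DifferentiableAt ℝ T x ↔ ∀ A B, DifferentiableAt ℝ (fun y => T y A B) x := by
  rw [differentiableAt_pi]
  exact forall_congr' fun A => differentiableAt_pi

/-- Identifies the array of partial derivatives with one Fréchet derivative, so that linear
operations such as `lieGen` and slicing pass through it. -/
theorem tenD_eq_fderiv {T : Coord n → Ten n r s} (hT : DifferentiableAt ℝ T x) :
    tenD k T x = fderiv ℝ T x (EuclideanSpace.single k 1) := by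
  funext A B
  have h1 : HasFDerivAt T (fderiv ℝ T x) x := hT.hasFDerivAt
  have h2 := (hasFDerivAt_pi'.1 (hasFDerivAt_pi'.1 h1 A) B).fderiv
  rw [tenD, partialD, h2]; rfl

theorem DifferentiableAt.linearMap_comp {r' s' : ℕ} (ℓ : Ten n r s →ₗ[ℝ] Ten n r' s')
    {T : Coord n → Ten n r s} (hT : DifferentiableAt ℝ T x) :
    DifferentiableAt ℝ (fun y => ℓ (T y)) x :=
  (LinearMap.toContinuousLinearMap ℓ).differentiableAt.comp x hT

theorem tenD_linearMap {r' s' : ℕ} (ℓ : Ten n r s →ₗ[ℝ] Ten n r' s') {T : Coord n → Ten n r s}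
    (hT : DifferentiableAt ℝ T x) : tenD k (fun y => ℓ (T y)) x = ℓ (tenD k T x) := by
  have h := (LinearMap.toContinuousLinearMap ℓ).hasFDerivAt.comp x hT.hasFDerivAt
  rw [tenD_eq_fderiv k hT, tenD_eq_fderiv k (DifferentiableAt.linearMap_comp ℓ hT)]
  exact congrArg (fun f => f (EuclideanSpace.single k 1)) h.fderiv

theorem differentiableAt_pair {P : Coord n → Ten n s r} {T : Coord n → Ten n r s}
    (hP : DifferentiableAt ℝ P x) (hT : DifferentiableAt ℝ T x) :
    DifferentiableAt ℝ (fun y => pair (P y) (T y)) x := by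
  rw [differentiableAt_ten_iff] at hP hT
  unfold pair
  exact DifferentiableAt.fun_sum fun A _ => DifferentiableAt.fun_sum fun B _ =>
    (hP B A).mul (hT A B)

theorem partialD_pair {P : Coord n → Ten n s r} {T : Coord n → Ten n r s}
    (hP : DifferentiableAt ℝ P x) (hT : DifferentiableAt ℝ T x) :
    partialD k (fun y => pair (P y) (T y)) x =
      pair (tenD k P x) (T x) + pair (P x) (tenD k T x) := by
  rw [differentiableAt_ten_iff] at hP hT
  unfold pair
  rw [partialD_sum k (F := fun A y => ∑ B, P y B A * T y A B)
      fun A _ => DifferentiableAt.fun_sum fun B _ => (hP B A).mul (hT A B),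
    ← Finset.sum_add_distrib]
  refine Finset.sum_congr rfl fun A _ => ?_
  rw [partialD_sum k (F := fun B y => P y B A * T y A B) fun B _ => (hP B A).mul (hT A B), ← Finset.sum_add_distrib]
  exact Finset.sum_congr rfl fun B _ => partialD_mul k (hP B A) (hT A B)

theorem differentiableAt_lieGen (α β : Fin n) {T : Coord n → Ten n r s}
    (hT : DifferentiableAt ℝ T x) : DifferentiableAt ℝ (fun y => lieGen α β (T y)) x :=
  DifferentiableAt.linearMap_comp (lieGenLin α β) hT

/-! The covariant derivative in the direction of a coordinate -/

/-- The covariant derivative along `∂_k`, without regard to indices that number a family. -/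
def slotD (Γ : Coord n → Conn n) (k : Fin n) (T : Coord n → Ten n r s) (x : Coord n) : Ten n r s :=
  tenD k T x - ∑ a, ∑ b, Γ x a b k • lieGen a b (T x)

variable (Γ : Coord n → Conn n)

theorem sum_smul_indexShift (N : Fin n → Fin n → ℝ) (F : (Fin s → Fin n) → ℝ)
    (B : Fin s → Fin n) :
    ∑ a, ∑ b, N a b * indexShift a b F B = ∑ m, ∑ l, N l (B m) * F (Function.update B m l) := by
  simp only [indexShift, Finset.mul_sum]
  have h : ∀ a, ∑ b, ∑ m, N a b * (if B m = b then F (Function.update B m a) else 0)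
      = ∑ m, N a (B m) * F (Function.update B m a) := by
    intro a
    rw [Finset.sum_comm]
    simp
  simp only [h]
  rw [Finset.sum_comm]

/-- The connection terms of all indices combine into `-Γ^a_{bk} S_a^b T`: the connection matrix acts
through the representation of `gl(n)`. This turns covariant calculus into the algebra of `lieGen`.
-/
theorem nabla_snoc (T : Coord n → Ten n r s) (A : Fin r → Fin n) (B : Fin s → Fin n) :
    nabla Γ T x A (Fin.snoc (α := fun _ => Fin n) B k) = slotD Γ k T x A B := by
  have h1 := sum_smul_indexShift (fun a b => Γ x a b k) (T x A) B
  have h2 := sum_smul_indexShift (fun a b => Γ x b a k) (fun A' => T x A' B) A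
  rw [Finset.sum_comm] at h2
  simp only [slotD, nabla, covD, tenD, Pi.sub_apply, Finset.sum_apply, Pi.smul_apply, smul_eq_mul,
    lieGen_eq_indexShift, mul_sub, Finset.sum_sub_distrib, h1, h2, Fin.init_snoc, Fin.snoc_last,
    dualConn, neg_mul, Finset.sum_neg_distrib]
  ring

theorem lowerSlice_nabla (T : Coord n → Ten n r s) :
    lowerSlice (nabla Γ T x) k = slotD Γ k T x := by
  funext A B
  exact nabla_snoc k Γ T A B

/-- If the frozen index only numbers a family, its connection term is missing from `slotD` of the
slice and has to be supplied separately. -/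
theorem lowerSlice_slotD (T : Coord n → Ten n r (s + 1)) (j : Fin n) :
    lowerSlice (slotD Γ k T x) j =
      slotD Γ k (fun y => lowerSlice (T y) j) x - ∑ a, Γ x a j k • lowerSlice (T x) a := by
  have h : ∀ a b, lowerSlice (Γ x a b k • lieGen a b (T x)) j =
      Γ x a b k • lieGen a b (lowerSlice (T x) j) +
        if j = b then Γ x a b k • lowerSlice (T x) a else 0 := by
    intro a b
    have := lowerSlice_lieGen a b (T x) j
    calc _ = Γ x a b k • lowerSlice (lieGen a b (T x)) j := rfl
      _ = _ := by rw [this]; split_ifs <;> simp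
  calc _ = tenD k (fun y => lowerSlice (T y) j) x
        - ∑ a, ∑ b, lowerSlice (Γ x a b k • lieGen a b (T x)) j := by
        funext A B
        simp [slotD, lowerSlice, tenD]
    _ = _ := by
        simp only [h, Finset.sum_add_distrib, slotD, Finset.sum_ite_eq, Finset.mem_univ, if_true]
        abel

theorem upperSlice_slotD (T : Coord n → Ten n (r + 1) s) (j : Fin n) :
    upperSlice (slotD Γ k T x) j =
      slotD Γ k (fun y => upperSlice (T y) j) x + ∑ b, Γ x j b k • upperSlice (T x) b := by
  have h : ∀ a b, upperSlice (Γ x a b k • lieGen a b (T x)) j =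
      Γ x a b k • lieGen a b (upperSlice (T x) j) -
        if j = a then Γ x a b k • upperSlice (T x) b else 0 := by
    intro a b
    have := upperSlice_lieGen a b (T x) j
    calc _ = Γ x a b k • upperSlice (lieGen a b (T x)) j := rfl
      _ = _ := by rw [this]; split_ifs <;> simp [smul_sub]
  calc _ = tenD k (fun y => upperSlice (T y) j) x
        - ∑ a, ∑ b, upperSlice (Γ x a b k • lieGen a b (T x)) j := by
        funext A B
        simp [slotD, upperSlice, tenD]
    _ = _ := by
        simp only [h, Finset.sum_sub_distrib, slotD]
        rw [Finset.sum_comm (f := fun a b => if j = a then Γ x a b k • upperSlice (T x) b else 0)]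
        simp only [Finset.sum_ite_eq, Finset.mem_univ, if_true]
        abel

theorem divLast_eq (P : Coord n → Ten n (r + 1) s) :
    divLast Γ P x = ∑ k, (slotD Γ k (fun y => upperSlice (P y) k) x
      + ∑ b, Γ x k b k • upperSlice (P x) b) := by
  simp only [← upperSlice_slotD]
  funext A B
  simp only [divLast, Finset.sum_apply, nabla_snoc]
  rfl

/-- Leibniz rule for a scalar: the connection terms of the two factors cancel by `pair_lieGen`. -/
theorem partialD_pair_slotD {P : Coord n → Ten n s r} {T : Coord n → Ten n r s}
    (hP : DifferentiableAt ℝ P x) (hT : DifferentiableAt ℝ T x) :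
    partialD k (fun y => pair (P y) (T y)) x =
      pair (slotD Γ k P x) (T x) + pair (P x) (slotD Γ k T x) := by
  have h : ∀ a b, Γ x a b k * pair (lieGen a b (P x)) (T x) =
      - (Γ x a b k * pair (P x) (lieGen a b (T x))) := fun a b => by
    linear_combination Γ x a b k * pair_lieGen a b (P x) (T x)
  simp only [partialD_pair k hP hT, slotD, pair_sub_left, pair_sub_right, pair_sum_left,
    pair_sum_right, pair_smul_left, pair_smul_right, h, Finset.sum_neg_distrib]
  ring

/-- The commutator of `S_a^b` with `S_α^β` gives the connection terms of the free indices `α`, `β`,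
with signs opposite to those in `mixedDiv`. In other words, `S_α^β` is covariantly constant once `α`
and `β` are differentiated too. -/
theorem slotD_lieGen (α β : Fin n) {T : Coord n → Ten n r s} (hT : DifferentiableAt ℝ T x) :
    slotD Γ k (fun y => lieGen α β (T y)) x = lieGen α β (slotD Γ k T x)
      + ∑ μ, Γ x μ α k • lieGen μ β (T x) - ∑ μ, Γ x β μ k • lieGen α μ (T x) := by
  have h1 : tenD k (fun y => lieGen α β (T y)) x = lieGen α β (tenD k T x) :=
    tenD_linearMap k (lieGenLin α β) hT
  have h2 : ∑ a, ∑ b, Γ x a b k • (if a = β then lieGen α b (T x) else 0) =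
      ∑ μ, Γ x β μ k • lieGen α μ (T x) := by
    rw [Finset.sum_comm]; simp
  have h3 : ∑ a, ∑ b, Γ x a b k • (if α = b then lieGen a β (T x) else 0) =
      ∑ μ, Γ x μ α k • lieGen μ β (T x) := by
    simp
  simp only [slotD, lieGen_commutator _ _ α β, lieGen_sub, lieGen_sum, lieGen_smul, smul_sub,
    smul_add, Finset.sum_sub_distrib, Finset.sum_add_distrib, h1, h2, h3]
  abel

/-! Divergence of the spin-type tensors -/

/-- The covariant divergence over `γ` of a tensor `U_α^{βγ}`. -/
def mixedDiv (Γ : Coord n → Conn n) (U : Coord n → Fin n → Fin n → Fin n → ℝ) (x : Coord n)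
    (α β : Fin n) : ℝ :=
  ∑ γ, (partialD γ (fun y => U y α β γ) x - ∑ μ, Γ x μ α γ * U x μ β γ
    + ∑ μ, Γ x β μ γ * U x α μ γ + ∑ μ, Γ x γ μ γ * U x α β μ)

theorem mixedDiv_add {U U' : Coord n → Fin n → Fin n → Fin n → ℝ} (α β : Fin n)
    (hU : ∀ γ, DifferentiableAt ℝ (fun y => U y α β γ) x)
    (hU' : ∀ γ, DifferentiableAt ℝ (fun y => U' y α β γ) x) :
    mixedDiv Γ (fun y α β γ => U y α β γ + U' y α β γ) x α β =
      mixedDiv Γ U x α β + mixedDiv Γ U' x α β := by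
  simp only [mixedDiv, ← Finset.sum_add_distrib, partialD_add _ (hU _) (hU' _), mul_add]
  refine Finset.sum_congr rfl fun γ _ => ?_
  simp only [Finset.sum_add_distrib]; ring

theorem mixedDiv_sum {S : Finset κ} {U : κ → Coord n → Fin n → Fin n → Fin n → ℝ} (α β : Fin n)
    (hU : ∀ i γ, DifferentiableAt ℝ (fun y => U i y α β γ) x) :
    mixedDiv Γ (fun y α β γ => ∑ i ∈ S, U i y α β γ) x α β = ∑ i ∈ S, mixedDiv Γ (U i) x α β := by
  classical
  induction S using Finset.induction_on with
  | empty => simp [mixedDiv, partialD]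
  | insert i S hi ih =>
    simp only [Finset.sum_insert hi, ← ih]
    exact mixedDiv_add Γ α β (hU i) fun γ => DifferentiableAt.fun_sum fun j _ => hU j γ

/-- The connection terms on `α` and `β` cancel by `slotD_lieGen`; only the one for the contracted
index `γ` of `P` survives. -/
theorem mixedDiv_pair_lieGen {P : Fin n → Coord n → Ten n s r} {T : Coord n → Ten n r s}
    (hP : ∀ γ, DifferentiableAt ℝ (P γ) x) (hT : DifferentiableAt ℝ T x) (α β : Fin n) :
    mixedDiv Γ (fun y α β γ => pair (P γ y) (lieGen α β (T y))) x α β =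
      ∑ γ, (pair (slotD Γ γ (P γ) x) (lieGen α β (T x))
        + ∑ μ, Γ x γ μ γ * pair (P μ x) (lieGen α β (T x))
        + pair (P γ x) (lieGen α β (slotD Γ γ T x))) := by
  refine Finset.sum_congr rfl fun γ _ => ?_
  rw [partialD_pair_slotD γ Γ (hP γ) (differentiableAt_lieGen α β hT), slotD_lieGen γ Γ α β hT]
  simp only [pair_sub_right, pair_add_right, pair_sum_right, pair_smul_right]
  ring

theorem mixedDiv_pair {P : Fin n → Fin n → Coord n → Ten n s r} {T : Fin n → Coord n → Ten n r s}
    (hP : ∀ β γ, DifferentiableAt ℝ (P β γ) x) (hT : ∀ α, DifferentiableAt ℝ (T α) x)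
    (α β : Fin n) :
    mixedDiv Γ (fun y α β γ => pair (P β γ y) (T α y)) x α β =
      ∑ γ, (pair (slotD Γ γ (P β γ) x) (T α x)
        + ∑ μ, Γ x β μ γ * pair (P μ γ x) (T α x)
        + ∑ μ, Γ x γ μ γ * pair (P β μ x) (T α x)
        + pair (P β γ x) (slotD Γ γ (T α) x) - ∑ μ, Γ x μ α γ * pair (P β γ x) (T μ x)) := by
  refine Finset.sum_congr rfl fun γ _ => ?_
  rw [partialD_pair_slotD γ Γ (hP β γ) (hT α)]
  ring

/-- The spin-type tensor `π^γ S_α^β T + q^{kγ} S_α^β T_{;k} + q^{βγ} T_{;α}` of one field. -/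
def fieldSpin (Γ : Coord n → Conn n) (π : Coord n → Ten n (s + 1) r) (q : Coord n → Ten n (s + 2) r)
    (T : Coord n → Ten n r s) (x : Coord n) (α β γ : Fin n) : ℝ :=
  pair (upperSlice (π x) γ) (lieGen α β (T x))
    + ∑ k, pair (upperSlice (upperSlice (q x) γ) k) (lieGen α β (lowerSlice (nabla Γ T x) k))
    + pair (upperSlice (upperSlice (q x) γ) β) (lowerSlice (nabla Γ T x) α)

end

/-! ### Divergence of the spin-type tensor of one field -/

section
variable {n r s : ℕ} {x : Coord n}

/-- `lowerSlice` as a linear map. -/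
def lowerSliceLin (k : Fin n) : Ten n r (s + 1) →ₗ[ℝ] Ten n r s where
  toFun T := lowerSlice T k
  map_add' _ _ := rfl
  map_smul' _ _ := rfl

/-- `upperSlice` as a linear map. -/
def upperSliceLin (k : Fin n) : Ten n (r + 1) s →ₗ[ℝ] Ten n r s where
  toFun T := upperSlice T k
  map_add' _ _ := rfl
  map_smul' _ _ := rfl

theorem differentiableAt_lowerSlice (k : Fin n) {T : Coord n → Ten n r (s + 1)}
    (hT : DifferentiableAt ℝ T x) : DifferentiableAt ℝ (fun y => lowerSlice (T y) k) x :=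
  DifferentiableAt.linearMap_comp (lowerSliceLin k) hT

theorem differentiableAt_upperSlice (k : Fin n) {T : Coord n → Ten n (r + 1) s}
    (hT : DifferentiableAt ℝ T x) : DifferentiableAt ℝ (fun y => upperSlice (T y) k) x :=
  DifferentiableAt.linearMap_comp (upperSliceLin k) hT

theorem upperSlice_sum {κ : Type*} (S : Finset κ) (k : Fin n) (T : κ → Ten n (r + 1) s) :
    upperSlice (∑ i ∈ S, T i) k = ∑ i ∈ S, upperSlice (T i) k :=
  map_sum (upperSliceLin k) T S

theorem upperSlice_divLast (Γ : Coord n → Conn n) (q : Coord n → Ten n (r + 2) s) (k : Fin n) :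
    upperSlice (divLast Γ q x) k = ∑ γ, (slotD Γ γ (fun y => upperSlice (upperSlice (q y) γ) k) x
      + ∑ μ, Γ x k μ γ • upperSlice (upperSlice (q x) γ) μ
      + ∑ μ, Γ x γ μ γ • upperSlice (upperSlice (q x) μ) k) := by
  rw [divLast_eq, upperSlice_sum]
  refine Finset.sum_congr rfl fun γ _ => ?_
  have h := upperSlice_slotD γ Γ (x := x) (fun y => upperSlice (q y) γ) k
  rw [← h]
  refine (map_add (upperSliceLin k) _ _).trans (congrArg _ ?_)
  exact map_sum (upperSliceLin k) _ _

theorem differentiableAt_fieldSpin {Γ : Coord n → Conn n} {π : Coord n → Ten n (s + 1) r}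
    {q : Coord n → Ten n (s + 2) r} {T : Coord n → Ten n r s}
    (hπ : DifferentiableAt ℝ π x) (hq : DifferentiableAt ℝ q x) (hT : DifferentiableAt ℝ T x)
    (hT1 : DifferentiableAt ℝ (nabla Γ T) x) (α β γ : Fin n) :
    DifferentiableAt ℝ (fun y => fieldSpin Γ π q T y α β γ) x :=
  ((differentiableAt_pair (differentiableAt_upperSlice γ hπ) (differentiableAt_lieGen α β hT)).add
    (DifferentiableAt.fun_sum fun k _ => differentiableAt_pair
      (differentiableAt_upperSlice k (differentiableAt_upperSlice γ hq))
      (differentiableAt_lieGen α β (differentiableAt_lowerSlice k hT1)))).add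
    (differentiableAt_pair (differentiableAt_upperSlice β (differentiableAt_upperSlice γ hq))
      (differentiableAt_lowerSlice α hT1))

/-- The covariant Leibniz rule for `div U`: each of the three summands of `U` yields one term with
the momentum differentiated and one with the field differentiated. In double slices the outer slice
takes the earlier index, so `upperSlice (upperSlice q γ) k` is `q^{kγ}`. -/
theorem mixedDiv_fieldSpin {Γ : Coord n → Conn n} {π : Coord n → Ten n (s + 1) r}
    {q : Coord n → Ten n (s + 2) r} {T : Coord n → Ten n r s}
    (hπ : DifferentiableAt ℝ π x) (hq : DifferentiableAt ℝ q x) (hT : DifferentiableAt ℝ T x)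
    (hT1 : DifferentiableAt ℝ (nabla Γ T) x) (α β : Fin n) :
    mixedDiv Γ (fieldSpin Γ π q T) x α β =
      pair (divLast Γ π x) (lieGen α β (T x))
      + ∑ γ, pair (upperSlice (π x) γ) (lieGen α β (lowerSlice (nabla Γ T x) γ))
      + ∑ k, pair (upperSlice (divLast Γ q x) k) (lieGen α β (lowerSlice (nabla Γ T x) k))
      + ∑ k, ∑ γ, pair (upperSlice (upperSlice (q x) γ) k)
          (lieGen α β (lowerSlice (lowerSlice (nabla Γ (nabla Γ T) x) γ) k))
      + pair (upperSlice (divLast Γ q x) β) (lowerSlice (nabla Γ T x) α)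
      + ∑ γ, pair (upperSlice (upperSlice (q x) γ) β)
          (lowerSlice (lowerSlice (nabla Γ (nabla Γ T) x) γ) α) := by
  have dq : ∀ k γ, DifferentiableAt ℝ (fun y => upperSlice (upperSlice (q y) γ) k) x :=
    fun k γ => differentiableAt_upperSlice k (differentiableAt_upperSlice γ hq)
  have dT : ∀ k, DifferentiableAt ℝ (fun y => lowerSlice (nabla Γ T y) k) x :=
    fun k => differentiableAt_lowerSlice k hT1
  have e1 := mixedDiv_pair_lieGen Γ (fun γ => differentiableAt_upperSlice γ hπ) hT α β
  have e2 := fun k => mixedDiv_pair_lieGen Γ (fun γ => dq k γ) (dT k) α β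
  have e3 := mixedDiv_pair Γ dq dT α β
  have d1 : ∀ γ, DifferentiableAt ℝ (fun y => pair (upperSlice (π y) γ) (lieGen α β (T y))) x :=
    fun γ => differentiableAt_pair (differentiableAt_upperSlice γ hπ)
      (differentiableAt_lieGen α β hT)
  have d2 : ∀ k γ, DifferentiableAt ℝ (fun y => pair (upperSlice (upperSlice (q y) γ) k)
      (lieGen α β (lowerSlice (nabla Γ T y) k))) x :=
    fun k γ => differentiableAt_pair (dq k γ) (differentiableAt_lieGen α β (dT k))
  have d3 : ∀ γ, DifferentiableAt ℝ (fun y => pair (upperSlice (upperSlice (q y) γ) β)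
      (lowerSlice (nabla Γ T y) α)) x := fun γ => differentiableAt_pair (dq β γ) (dT α)
  have split : mixedDiv Γ (fieldSpin Γ π q T) x α β = _ :=
    mixedDiv_add Γ α β (fun γ => (d1 γ).add (DifferentiableAt.fun_sum fun k _ => d2 k γ)) d3
  rw [split, mixedDiv_add Γ α β d1 (fun γ => DifferentiableAt.fun_sum fun k _ => d2 k γ),
    mixedDiv_sum Γ α β d2, e1, e3, Finset.sum_congr rfl fun k _ => e2 k]
  simp only [upperSlice_divLast]
  simp only [divLast_eq, lowerSlice_nabla, lowerSlice_slotD]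
  simp only [pair_sub_right, pair_add_left, pair_sum_left, pair_sum_right, pair_smul_left,
    pair_smul_right, lieGen_sub, lieGen_sum, lieGen_smul, Finset.sum_add_distrib,
    Finset.sum_sub_distrib]
  -- The contracted index `k` of `q^{kγ} S φ_{;k}` produces connection terms of opposite sign from
  -- `q` and from `φ_{;k}`; renaming `k ↔ μ` in one of them makes them cancel.
  have sw : ∑ k, ∑ γ, ∑ μ, Γ x k μ γ * pair (upperSlice (upperSlice (q x) γ) μ)
      (lieGen α β (slotD Γ k T x)) = ∑ k, ∑ γ, ∑ μ, Γ x μ k γ *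
        pair (upperSlice (upperSlice (q x) γ) k) (lieGen α β (slotD Γ μ T x)) := by
    rw [Finset.sum_comm, Finset.sum_comm (f := fun k γ => ∑ μ, Γ x μ k γ * _)]
    exact Finset.sum_congr rfl fun γ _ => Finset.sum_comm
  rw [sw]
  ring

end

/-! Contraction of lower indices commutes with the covariant differentiation -/

section
variable {n r s : ℕ} {x : Coord n}

theorem partialD_prod {κ : Type*} [DecidableEq κ] (k : Fin n) {S : Finset κ} {F : κ → Coord n → ℝ}
    (hF : ∀ i ∈ S, DifferentiableAt ℝ (F i) x) :
    partialD k (fun y => ∏ i ∈ S, F i y) x =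
      ∑ i ∈ S, (∏ j ∈ S.erase i, F j x) * partialD k (F i) x := by
  have h := (HasFDerivAt.finsetProd (g := F) (u := S) (x := x)
    fun i hi => (hF i hi).hasFDerivAt).fderiv
  rw [partialD, h]
  simp [partialD]

theorem partialD_contractLower {F : Fin s → Coord n → Matrix (Fin n) (Fin n) ℝ}
    {T : Coord n → Ten n r s} (hF : ∀ m i j, DifferentiableAt ℝ (fun y => F m y i j) x)
    (hT : DifferentiableAt ℝ T x) (k : Fin n) (A : Fin r → Fin n) (B : Fin s → Fin n) :
    partialD k (fun y => contractLower (fun m => F m y) (T y) A B) x =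
      ∑ D : Fin s → Fin n, ((∑ m, (∏ j ∈ Finset.univ.erase m, F j x (D j) (B j))
          * partialD k (fun y => F m y (D m) (B m)) x) * T x A D
        + (∏ m, F m x (D m) (B m)) * partialD k (fun y => T y A D) x) := by
  have hP : ∀ D : Fin s → Fin n, DifferentiableAt ℝ (fun y => ∏ m, F m y (D m) (B m)) x :=
    fun D => (HasFDerivAt.finsetProd (g := fun m y => F m y (D m) (B m))
      fun m _ => (hF m _ _).hasFDerivAt).differentiableAt
  rw [differentiableAt_ten_iff] at hT
  unfold contractLower
  rw [partialD_sum k (F := fun D y => (∏ m, F m y (D m) (B m)) * T y A D)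
    fun D _ => (hP D).mul (hT A D)]
  refine Finset.sum_congr rfl fun D _ => ?_
  rw [partialD_mul k (hP D) (hT A D),
    partialD_prod k (F := fun m y => F m y (D m) (B m)) fun m _ => hF m _ _]

theorem prod_erase_congr_update {D : Fin s → Fin n} (m : Fin s) (l : Fin n)
    (f : Fin s → Fin n → ℝ) :
    ∏ j ∈ Finset.univ.erase m, f j (Function.update D m l j) =
      ∏ j ∈ Finset.univ.erase m, f j (D j) :=
  Finset.prod_congr rfl fun j hj => by rw [Function.update_of_ne (Finset.ne_of_mem_erase hj)]

theorem prod_update_eq (D : Fin s → Fin n) (m : Fin s) (l : Fin n) (f : Fin s → Fin n → ℝ) :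
    ∏ j, f j (Function.update D m l j) = (∏ j ∈ Finset.univ.erase m, f j (D j)) * f m l := by
  rw [← Finset.prod_erase_mul _ _ (Finset.mem_univ m), prod_erase_congr_update (D := D),
    Function.update_self]

theorem contractLower_snoc_one (F : Fin s → Matrix (Fin n) (Fin n) ℝ) (T : Ten n r (s + 1))
    (A : Fin r → Fin n) (B : Fin s → Fin n) (k : Fin n) :
    contractLower (Fin.snoc (α := fun _ => Matrix (Fin n) (Fin n) ℝ) F 1) T A
        (Fin.snoc (α := fun _ => Fin n) B k) =
      contractLower F (lowerSlice T k) A B := by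
  simp only [contractLower, sum_snoc, Fin.prod_univ_castSucc, Fin.snoc_castSucc, Fin.snoc_last,
    Matrix.one_apply, lowerSlice]
  refine Finset.sum_congr rfl fun D _ => ?_
  simp

/-- The hypothesis `compat` says that each `F m` is covariantly constant, its upper index
differentiated with `Λ m` and its lower one with the dual of `Γ`. Contraction with it therefore
replaces `Λ m` by the dual of `Γ` in each slot. -/
theorem nabla_contractLower {Γ : Coord n → Conn n} {Λ : Fin s → Coord n → Conn n}
    {F : Fin s → Coord n → Matrix (Fin n) (Fin n) ℝ}
    {T : Coord n → Ten n r s} (hF : ∀ m i j, DifferentiableAt ℝ (fun y => F m y i j) x)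
    (hT : DifferentiableAt ℝ T x)
    (compat : ∀ m i j k, partialD k (fun y => F m y i j) x =
      (∑ l, Γ x l j k * F m x i l) + ∑ l, Λ m x i l k * F m x l j) :
    nabla Γ (fun y => contractLower (fun m => F m y) (T y)) x =
      contractLower (Fin.snoc (α := fun _ => Matrix (Fin n) (Fin n) ℝ) (fun m => F m x) 1)
        (covD Γ Λ T x) := by
  funext A B'
  obtain ⟨B, k, rfl⟩ : ∃ (B : Fin s → Fin n) (k : Fin n),
      B' = Fin.snoc (α := fun _ => Fin n) B k := ⟨_, _, (Fin.snoc_init_self B').symm⟩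
  rw [contractLower_snoc_one]
  simp only [nabla, covD, Fin.init_snoc, Fin.snoc_last, partialD_contractLower hF hT, compat]
  unfold contractLower lowerSlice
  simp only [covD, Fin.init_snoc, Fin.snoc_last]
  set R : Fin s → (Fin s → Fin n) → ℝ := fun m D =>
    ∏ j ∈ Finset.univ.erase m, F j x (D j) (B j) with hR
  have e1 : ∀ (D : Fin s → Fin n) (m : Fin s) (l : Fin n),
      ∏ j, F j x (D j) (Function.update B m l j) = R m D * F m x (D m) l := fun D m l =>
    prod_update_eq B m l fun j b => F j x (D j) b
  have e2 : ∀ (D : Fin s → Fin n) (m : Fin s), ∏ j, F j x (D j) (B j) = R m D * F m x (D m) (B m) :=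
    fun D m => (Finset.prod_erase_mul _ _ (Finset.mem_univ m)).symm
  have e3 : ∀ (D : Fin s → Fin n) (m : Fin s) (l : Fin n), R m (Function.update D m l) = R m D :=
    fun D m l => prod_erase_congr_update (D := D) m l fun j d => F j x d (B j)
  -- Exchanging `D m` with `l` moves `Λ m` from the factor `F m` to the tensor. The `Γ` part of
  -- `∂F`, isolated in `s1`, cancels against the dual connection acting on the free index.
  have key : ∀ m : Fin s,
      ∑ D : Fin s → Fin n, ∑ l, R m D * (Λ m x (D m) l k * F m x l (B m)) * T x A D =
      ∑ D : Fin s → Fin n, ∑ l, (∏ j, F j x (D j) (B j))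
        * (Λ m x l (D m) k * T x A (Function.update D m l)) := by
    intro m
    rw [sum_update_swap m]
    refine Finset.sum_congr rfl fun D _ => Finset.sum_congr rfl fun l _ => ?_
    rw [e3, e2 D m, Function.update_self]; ring
  have s1 : ∑ D : Fin s → Fin n, (∑ m, R m D * ((∑ l, Γ x l (B m) k * F m x (D m) l)
        + ∑ l, Λ m x (D m) l k * F m x l (B m))) * T x A D =
      (∑ m, ∑ l, Γ x l (B m) k * ∑ D : Fin s → Fin n, R m D * F m x (D m) l * T x A D)
      + ∑ D : Fin s → Fin n, ∑ m, ∑ l, (∏ j, F j x (D j) (B j))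
        * (Λ m x l (D m) k * T x A (Function.update D m l)) := by
    rw [Finset.sum_comm (f := fun (D : Fin s → Fin n) m => ∑ l, (∏ j, F j x (D j) (B j)) * _)]
    simp only [← key]
    simp only [Finset.mul_sum, mul_add, add_mul, Finset.sum_mul, Finset.sum_add_distrib]
    congr 1
    · rw [Finset.sum_comm]
      refine Finset.sum_congr rfl fun m _ => ?_
      rw [Finset.sum_comm]
      exact Finset.sum_congr rfl fun l _ => Finset.sum_congr rfl fun D _ => by ring
    · rw [Finset.sum_comm]
  have s2 : ∑ D : Fin s → Fin n, (∏ j, F j x (D j) (B j)) *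
      (∑ m, ∑ l, Γ x (A m) l k * T x (Function.update A m l) D) =
      ∑ m, ∑ l, Γ x (A m) l k * ∑ D : Fin s → Fin n, (∏ j, F j x (D j) (B j)) *
        T x (Function.update A m l) D := by
    simp only [Finset.mul_sum]
    rw [Finset.sum_comm]
    refine Finset.sum_congr rfl fun m _ => ?_
    rw [Finset.sum_comm]
    exact Finset.sum_congr rfl fun l _ => Finset.sum_congr rfl fun D _ => by ring
  have s3 : ∀ D : Fin s → Fin n, (∏ j, F j x (D j) (B j)) *
      (∑ m, ∑ l, Λ m x l (D m) k * T x A (Function.update D m l)) =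
      ∑ m, ∑ l, (∏ j, F j x (D j) (B j))
        * (Λ m x l (D m) k * T x A (Function.update D m l)) := fun D => by
    simp only [Finset.mul_sum]
  simp only [mul_add, Finset.sum_add_distrib, s3, s2, e1, dualConn, neg_mul,
    Finset.sum_neg_distrib] at s1 ⊢
  rw [s1]
  ring

end

/-! The infinitesimal form of the invariance of a Lagrangian -/

section
variable {n r s : ℕ}

theorem sum_prod_erase_one_mul (A : Fin r → Fin n) (m : Fin r) (h : (Fin r → Fin n) → ℝ) :
    ∑ C : Fin r → Fin n,
      (∏ j ∈ Finset.univ.erase m, (1 : Matrix (Fin n) (Fin n) ℝ) (A j) (C j)) * h C =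
      ∑ l, h (Function.update A m l) := by
  symm
  -- The Kronecker deltas kill every `C` that differs from `A` outside slot `m`.
  refine Fintype.sum_of_injective (Function.update A m) (Function.update_injective A m) _ _ ?_ ?_
  · intro C hC
    have : ∃ j, j ≠ m ∧ A j ≠ C j := by
      by_contra! hc
      refine hC ⟨C m, ?_⟩
      funext j
      by_cases hj : j = m
      · subst hj; simp
      · simp [hj, hc j hj]
    obtain ⟨j, hj, hA⟩ := this
    rw [Finset.prod_eq_zero (i := j) (by simp [hj]) (by simp [hA]), zero_mul]
  · intro l
    rw [Finset.prod_eq_one, one_mul]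
    intro j hj
    rw [Function.update_of_ne (Finset.ne_of_mem_erase hj), Matrix.one_apply_eq]

theorem prod_one_apply (A C : Fin r → Fin n) :
    ∏ j, (1 : Matrix (Fin n) (Fin n) ℝ) (A j) (C j) = if A = C then 1 else 0 := by
  simp only [Matrix.one_apply, Finset.prod_ite_zero, Finset.prod_const_one, funext_iff,
    Finset.mem_univ, true_imp_iff]

theorem tensorAct_one_one (T : Ten n r s) : tensorAct 1 1 T = T := by
  funext A B
  simp [tensorAct, prod_one_apply]

/-- The derivative of the group action at the identity. The sign is negative because `lieGen`
follows the Lie derivative, with plus on lower indices, whereas `J` acts on upper ones. -/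
theorem hasDerivAt_tensorAct {J Ji : ℝ → Matrix (Fin n) (Fin n) ℝ} {N : Matrix (Fin n) (Fin n) ℝ}
    (hJ0 : J 0 = 1) (hJi0 : Ji 0 = 1) (hJ : ∀ i j, HasDerivAt (fun t => J t i j) (N i j) 0)
    (hJi : ∀ i j, HasDerivAt (fun t => Ji t i j) (- N i j) 0) (T : Ten n r s) :
    HasDerivAt (fun t => tensorAct (J t) (Ji t) T) (- ∑ a, ∑ b, N a b • lieGen a b T) 0 := by
  rw [hasDerivAt_pi]; intro A
  rw [hasDerivAt_pi]; intro B
  have h1 : ∀ C : Fin r → Fin n, HasDerivAt (fun t => ∏ m, J t (A m) (C m))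
      (∑ m, (∏ j ∈ Finset.univ.erase m, (1 : Matrix (Fin n) (Fin n) ℝ) (A j) (C j))
        * N (A m) (C m)) 0 := fun C => by
    have := HasDerivAt.fun_finsetProd (u := Finset.univ) (x := (0 : ℝ))
      (f := fun m t => J t (A m) (C m)) fun m _ => hJ (A m) (C m)
    simpa only [hJ0, smul_eq_mul] using this
  have h2 : ∀ D : Fin s → Fin n, HasDerivAt (fun t => ∏ m, Ji t (D m) (B m))
      (∑ m, (∏ j ∈ Finset.univ.erase m, (1 : Matrix (Fin n) (Fin n) ℝ) (B j) (D j))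
        * (- N (D m) (B m))) 0 := fun D => by
    have := HasDerivAt.fun_finsetProd (u := Finset.univ) (x := (0 : ℝ))
      (f := fun m t => Ji t (D m) (B m)) fun m _ => hJi (D m) (B m)
    simp only [hJi0, smul_eq_mul] at this
    simpa only [Matrix.one_apply, eq_comm] using this
  have h3 := HasDerivAt.fun_sum (u := Finset.univ) fun C _ => HasDerivAt.fun_sum (u := Finset.univ)
    fun D _ => ((h1 C).mul (h2 D)).mul_const (T C D)
  refine h3.congr_deriv ?_
  have g1 := sum_smul_indexShift (fun a b => N a b) (T A) B
  have g2 := sum_smul_indexShift (fun a b => N b a) (fun A' => T A' B) A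
  rw [Finset.sum_comm] at g2
  have k1 : ∑ C : Fin r → Fin n, ∑ D : Fin s → Fin n,
      (∑ m, (∏ j ∈ Finset.univ.erase m, (1 : Matrix (Fin n) (Fin n) ℝ) (A j) (C j))
        * N (A m) (C m)) * (if D = B then 1 else 0) * T C D =
      ∑ m, ∑ l, N (A m) l * T (Function.update A m l) B := by
    simp only [mul_ite, mul_one, mul_zero, ite_mul, zero_mul, Finset.sum_ite_eq', Finset.mem_univ,
      if_true, Finset.sum_mul]
    rw [Finset.sum_comm]
    refine Finset.sum_congr rfl fun m _ => ?_
    simp only [mul_assoc]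
    rw [sum_prod_erase_one_mul A m fun C => N (A m) (C m) * T C B]
    simp
  have k2 : ∑ C : Fin r → Fin n, ∑ D : Fin s → Fin n,
      (if A = C then 1 else 0) *
      (∑ m, (∏ j ∈ Finset.univ.erase m, (1 : Matrix (Fin n) (Fin n) ℝ) (B j) (D j))
        * (- N (D m) (B m))) * T C D =
      - ∑ m, ∑ l, N l (B m) * T A (Function.update B m l) := by
    rw [Finset.sum_eq_single A (by
      intro C _ hC; simp [hC.symm]) (by simp)]
    simp only [if_true, one_mul, Finset.sum_mul]
    rw [Finset.sum_comm, ← Finset.sum_neg_distrib]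
    refine Finset.sum_congr rfl fun m _ => ?_
    simp only [mul_assoc]
    rw [sum_prod_erase_one_mul B m fun D => - N (D m) (B m) * T A D]
    simp
  simp only [hJ0, hJi0, prod_one_apply, add_mul, Finset.sum_add_distrib, k1, k2]
  simp only [Pi.neg_apply, Finset.sum_apply, Pi.smul_apply, smul_eq_mul,
    lieGen_eq_indexShift, mul_sub, Finset.sum_sub_distrib, g1, g2]
  ring

/-- The infinitesimal action of the linear group on the arguments of a Lagrangian. -/
def lieJet {ι : Type*} {τ : ι → ℕ × ℕ} (α β : Fin n) (z : JetSpace n τ) : JetSpace n τ :=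
  fun c => (lieGen α β (z c).1, lieGen α β (z c).2.1, lieGen α β (z c).2.2)

theorem single_mul_single_self (α β : Fin n) :
    Matrix.single α β (1 : ℝ) * Matrix.single α β 1 =
      (if α = β then (1 : ℝ) else 0) • Matrix.single α β 1 := by
  by_cases h : α = β
  · subst h; simp
  · rw [Matrix.single_mul_single_of_ne _ _ _ _ (Ne.symm h)]; simp [h]

/-- With `E² = δE` the product is `1 + (a - b - abδ)E`, where `δ` is `1` on the diagonal and `0` off
it. -/
theorem elementary_mul (α β : Fin n) {a b : ℝ}
    (h : a - b - a * b * (if α = β then (1 : ℝ) else 0) = 0) :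
    (1 + a • Matrix.single α β (1 : ℝ)) * (1 - b • Matrix.single α β (1 : ℝ)) = 1 ∧
    (1 - b • Matrix.single α β (1 : ℝ)) * (1 + a • Matrix.single α β (1 : ℝ)) = 1 := by
  have e := single_mul_single_self α β
  have h' := congrArg (fun t : ℝ => t • Matrix.single α β (1 : ℝ)) h
  simp only [sub_smul, zero_smul] at h'
  constructor
  · rw [add_mul, mul_sub, mul_sub]
    simp only [one_mul, mul_one, smul_mul_assoc, mul_smul_comm, e, smul_smul, ← mul_assoc]
    rw [← sub_eq_zero, ← h', mul_comm b a]; abel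
  · rw [sub_mul, mul_add, mul_add]
    simp only [one_mul, mul_one, smul_mul_assoc, mul_smul_comm, e, smul_smul, ← mul_assoc]
    rw [← sub_eq_zero, ← h']; abel

/-- `L` is constant along the orbit of `z` under `1 + tE`, with `E` an elementary matrix;
differentiating at `t = 0` gives the claim. -/
theorem fderiv_lieJet {ι : Type*} [Fintype ι] {τ : ι → ℕ × ℕ} (L : LagrangianInvariant n τ)
    {z : JetSpace n τ} (hz : z ∈ L.dom) (α β : Fin n) :
    fderiv ℝ L.toFun z (lieJet α β z) = 0 := by
  set δ : ℝ := if α = β then 1 else 0 with hδ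
  set E : Matrix (Fin n) (Fin n) ℝ := Matrix.single α β 1 with hE
  let J : ℝ → Matrix (Fin n) (Fin n) ℝ := fun t => 1 + t • E
  -- The explicit inverse of `1 + tE`, obtained by solving `a - b - abδ = 0` for `b` with `a = t`.
  let Ji : ℝ → Matrix (Fin n) (Fin n) ℝ := fun t => 1 - (t / (1 + t * δ)) • E
  have hJ0 : J 0 = 1 := by simp [J]
  have hJi0 : Ji 0 = 1 := by simp [Ji]
  have hJ : ∀ i j, HasDerivAt (fun t => J t i j) (E i j) 0 := fun i j => by
    have := ((hasDerivAt_id (0 : ℝ)).mul_const (E i j)).const_add ((1 : Matrix _ _ ℝ) i j)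
    simpa [J] using this
  have hJi : ∀ i j, HasDerivAt (fun t => Ji t i j) (- E i j) 0 := fun i j => by
    have h1 : HasDerivAt (fun t : ℝ => t / (1 + t * δ)) 1 0 := by
      have := (hasDerivAt_id' (0 : ℝ)).fun_div
        (((hasDerivAt_id' (0 : ℝ)).mul_const δ).const_add 1) (by simp)
      simpa using this
    have := (h1.mul_const (E i j)).const_sub ((1 : Matrix _ _ ℝ) i j)
    simpa [Ji] using this
  let γ : ℝ → JetSpace n τ := fun t c =>
    (tensorAct (J t) (Ji t) (z c).1, tensorAct (J t) (Ji t) (z c).2.1,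
      tensorAct (J t) (Ji t) (z c).2.2)
  have hγ0 : γ 0 = z := by
    funext c
    simp only [γ, hJ0, hJi0, tensorAct_one_one]
  have hsum : ∀ {r s : ℕ} (T : Ten n r s), ∑ a, ∑ b, E a b • lieGen a b T = lieGen α β T := by
    intro r s T
    rw [Finset.sum_eq_single α, Finset.sum_eq_single β]
    · simp [hE]
    · intro b _ hb; simp [hE, hb.symm]
    · simp
    · intro a _ ha; simp [hE, ha.symm]
    · simp
  have hγ : HasDerivAt γ (- lieJet α β z) 0 := by
    rw [hasDerivAt_pi]; intro c
    have hd : ∀ {r s : ℕ} (T : Ten n r s),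
        HasDerivAt (fun t => tensorAct (J t) (Ji t) T) (- lieGen α β T) 0 := fun T => by
      have := hasDerivAt_tensorAct hJ0 hJi0 hJ hJi T
      rwa [hsum] at this
    exact (hd _).prodMk ((hd _).prodMk (hd _))
  have hL : HasFDerivAt L.toFun (fderiv ℝ L.toFun z) (γ 0) := by
    rw [hγ0]
    exact ((L.smooth.contDiffAt (L.isOpen_dom.mem_nhds hz)).differentiableAt (by simp)).hasFDerivAt
  have hcomp := hL.comp_hasDerivAt (0 : ℝ) hγ
  have hconst : L.toFun ∘ γ =ᶠ[nhds 0] fun _ => L.toFun z := by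
    -- In the diagonal case `1 + tE` is singular at `t = -1`, so invariance is used only for `t`
    -- near `0`.
    have hne : ∀ᶠ t : ℝ in nhds 0, 1 + t * δ ≠ 0 := by
      have : ContinuousAt (fun t : ℝ => 1 + t * δ) 0 := by fun_prop
      exact this.eventually_ne (by simp)
    filter_upwards [hne] with t ht
    have hm := elementary_mul α β (a := t) (b := t / (1 + t * δ)) (by
      rw [← hδ]; field_simp; ring)
    exact L.invariant ⟨J t, Ji t, hm.1, hm.2⟩ z hz
  have := hcomp.unique ((hasDerivAt_const (0 : ℝ) (L.toFun z)).congr_of_eventuallyEq hconst)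
  simpa using this

end

/-! The covariant Noether identity of one field -/

section
variable {n r s : ℕ} {x : Coord n}

theorem pair_eq_sum_slice (P : Ten n (s + 1) r) (T : Ten n r (s + 1)) :
    pair P T = ∑ k, pair (upperSlice P k) (lowerSlice T k) := by
  simp only [pair, sum_snoc]
  rw [Finset.sum_comm (s := Finset.univ (α := Fin n))]
  exact Finset.sum_congr rfl fun A _ => Finset.sum_comm

/-- Separates the action on the indices of the field from the action on the differentiation index.
-/
theorem pair_lieGen_slice (α β : Fin n) (P : Ten n (s + 1) r) (T : Ten n r (s + 1)) :
    pair P (lieGen α β T) = ∑ k, pair (upperSlice P k) (lieGen α β (lowerSlice T k))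
      + pair (upperSlice P β) (lowerSlice T α) := by
  have h : ∀ k, pair (upperSlice P k) (if k = β then lowerSlice T α else 0) =
      if k = β then pair (upperSlice P k) (lowerSlice T α) else 0 := fun k => by
    split_ifs
    · rfl
    · simp [← pairLin_apply]
  simp only [pair_eq_sum_slice P, lowerSlice_lieGen, pair_add_right, Finset.sum_add_distrib, h]
  simp

theorem tenD_sub (k : Fin n) {P P' : Coord n → Ten n r s} (hP : DifferentiableAt ℝ P x)
    (hP' : DifferentiableAt ℝ P' x) :
    tenD k (fun y => P y - P' y) x = tenD k P x - tenD k P' x := by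
  rw [tenD_eq_fderiv k hP, tenD_eq_fderiv k hP', tenD_eq_fderiv k (hP.fun_sub hP'),
    fderiv_fun_sub hP hP']
  rfl

theorem divLast_sub (Γ : Coord n → Conn n) {P P' : Coord n → Ten n (r + 1) s}
    (hP : DifferentiableAt ℝ P x) (hP' : DifferentiableAt ℝ P' x) :
    divLast Γ (fun y => P y - P' y) x = divLast Γ P x - divLast Γ P' x := by
  have h : ∀ (k : Fin n) (T T' : Ten n (r + 1) s),
      upperSlice (T - T') k = upperSlice T k - upperSlice T' k := fun _ _ _ => rfl
  simp only [divLast_eq, ← Finset.sum_sub_distrib, slotD, h]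
  refine Finset.sum_congr rfl fun k _ => ?_
  rw [tenD_sub k (differentiableAt_upperSlice k hP) (differentiableAt_upperSlice k hP')]
  simp only [lieGen_sub, smul_sub, Finset.sum_sub_distrib]
  abel

/-- Here `P0`, `P1`, `q` stand for the derivatives of `L` in `φ`, `φ_{;k}`, `φ_{;k;l}`. The terms of
`div U` with `π` differentiated form the Euler–Lagrange expression, up to `P0`. The `q` divergence
inside `π` cancels against `(q^{kγ})_{;γ}` from the other summands. The canonical tensor supplies
the missing action of `S_α^β` on the last differentiation index: `P1^β φ_{;α}` and `q^{kβ}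
φ_{;k;α}`. -/
theorem noether_identity {Γ : Coord n → Conn n} (P0 : Ten n s r) {P1 : Coord n → Ten n (s + 1) r}
    {q : Coord n → Ten n (s + 2) r} {T : Coord n → Ten n r s}
    (hP1 : DifferentiableAt ℝ P1 x) (hq : DifferentiableAt ℝ q x)
    (hdq : DifferentiableAt ℝ (divLast Γ q) x) (hT : DifferentiableAt ℝ T x)
    (hT1 : DifferentiableAt ℝ (nabla Γ T) x) (α β : Fin n) :
    mixedDiv Γ (fieldSpin Γ (fun y => P1 y - divLast Γ q y) q T) x α β
      + (pair (upperSlice (P1 x - divLast Γ q x) β) (lowerSlice (nabla Γ T x) α)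
        + ∑ k, pair (upperSlice (upperSlice (q x) β) k)
          (lowerSlice (lowerSlice (nabla Γ (nabla Γ T) x) α) k)) =
    - pair (P0 - divLast Γ P1 x + divLast Γ (divLast Γ q) x) (lieGen α β (T x))
      + (pair P0 (lieGen α β (T x)) + pair (P1 x) (lieGen α β (nabla Γ T x))
        + pair (q x) (lieGen α β (nabla Γ (nabla Γ T) x))) := by
  have hu : ∀ (k : Fin n) (T T' : Ten n (s + 1) r),
      upperSlice (T - T') k = upperSlice T k - upperSlice T' k := fun _ _ _ => rfl
  rw [mixedDiv_fieldSpin (hP1.fun_sub hdq) hq hT hT1, divLast_sub Γ hP1 hdq,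
    pair_lieGen_slice α β (P1 x), pair_lieGen_slice α β (q x)]
  simp only [pair_lieGen_slice α β (upperSlice (q x) _), Finset.sum_add_distrib,
    pair_eq_sum_slice (upperSlice (q x) β), hu, pair_sub_left, pair_add_left,
    Finset.sum_sub_distrib]
  rw [Finset.sum_comm (f := fun k γ => pair (upperSlice (upperSlice (q x) γ) k)
          (lieGen α β (lowerSlice (lowerSlice (nabla Γ (nabla Γ T) x) γ) k)))]
  ring

/-! Locality -/

theorem partialD_congr {F G : Coord n → ℝ} (k : Fin n) (h : F =ᶠ[nhds x] G) :
    partialD k F x = partialD k G x := by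
  rw [partialD, partialD, h.fderiv_eq]

/-- Locality matters because the identification of the jets with iterated `nabla` holds only on the
target of the chart. -/
theorem nabla_congr {Γ : Coord n → Conn n} {T T' : Coord n → Ten n r s} (h : T =ᶠ[nhds x] T') :
    nabla Γ T x = nabla Γ T' x := by
  funext A B
  simp only [nabla, covD, h.eq_of_nhds]
  rw [partialD_congr (G := fun y => T' y A (Fin.init B)) _ (h.mono fun y hy => by simp only [hy])]

theorem mixedDiv_congr {Γ : Coord n → Conn n} {U U' : Coord n → Fin n → Fin n → Fin n → ℝ}
    (h : U =ᶠ[nhds x] U') (α β : Fin n) : mixedDiv Γ U x α β = mixedDiv Γ U' x α β := by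
  have hp : ∀ γ, partialD γ (fun y => U y α β γ) x = partialD γ (fun y => U' y α β γ) x :=
    fun γ => partialD_congr γ (h.mono fun y hy => by simp only [hy])
  simp only [mixedDiv, h.eq_of_nhds, hp]

/-! Divergences in terms of the components -/

theorem divLast_oneOne (Γ : Coord n → Conn n) (W : Coord n → Fin n → Fin n → Fin n → ℝ)
    (α β : Fin n) :
    divLast Γ (fun y (C : Fin 2 → Fin n) (D : Fin 1 → Fin n) => W y (D 0) (C 0) (C 1)) x
      ![β] ![α] = mixedDiv Γ W x α β := by
  refine Finset.sum_congr rfl fun γ _ => ?_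
  have e1 : (Fin.snoc (α := fun _ => Fin n) ![β] γ : Fin 2 → Fin n) = ![β, γ] := by
    funext i; fin_cases i <;> rfl
  have e2 : Fin.init (α := fun _ => Fin n) (Fin.snoc (α := fun _ => Fin n) ![α] γ) = ![α] :=
    Fin.init_snoc _ _
  have e3 : ∀ μ, Function.update ![β, γ] 0 μ = ![μ, γ] := fun μ => by
    funext i; fin_cases i <;> rfl
  have e4 : ∀ μ, Function.update ![β, γ] 1 μ = ![β, μ] := fun μ => by
    funext i; fin_cases i <;> rfl
  have e5 : ∀ μ, Function.update ![α] 0 μ = ![μ] := fun μ => by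
    funext i; fin_cases i; rfl
  -- Unfolding `divLast` leaves the index type in the form `Fin (r + 1)`, so the two-term sum is
  -- restated for that form.
  have h2 : ∀ f : Fin (1 + 1) → ℝ, ∑ m, f m = f (0 : Fin 2) + f (1 : Fin 2) := Fin.sum_univ_two
  simp only [nabla, covD, e1, e2, Fin.snoc_last, dualConn, h2, Fin.sum_univ_one,
    Matrix.cons_val_zero, Matrix.cons_val_one, e3, e4, e5, neg_mul, Finset.sum_neg_distrib]
  ring

theorem divLast_three (Γ : Coord n → Conn n) (Y : Coord n → Fin n → Fin n → Fin n → ℝ)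
    (δ β : Fin n) :
    divLast Γ (fun y (C : Fin 3 → Fin n) (_ : Fin 0 → Fin n) => Y y (C 0) (C 1) (C 2)) x
      ![δ, β] ![] = ∑ γ, (partialD γ (fun y => Y y δ β γ) x + ∑ μ, Γ x δ μ γ * Y x μ β γ
        + ∑ μ, Γ x β μ γ * Y x δ μ γ + ∑ μ, Γ x γ μ γ * Y x δ β μ) := by
  refine Finset.sum_congr rfl fun γ _ => ?_
  have e1 : (Fin.snoc (α := fun _ => Fin n) ![δ, β] γ : Fin 3 → Fin n) = ![δ, β, γ] := by
    funext i; fin_cases i <;> rfl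
  have e3 : ∀ μ, Function.update ![δ, β, γ] 0 μ = ![μ, β, γ] := fun μ => by
    funext i; fin_cases i <;> rfl
  have e4 : ∀ μ, Function.update ![δ, β, γ] 1 μ = ![δ, μ, γ] := fun μ => by
    funext i; fin_cases i <;> rfl
  have e5 : ∀ μ, Function.update ![δ, β, γ] 2 μ = ![δ, β, μ] := fun μ => by
    funext i; fin_cases i <;> rfl
  have e6 : (Fin.snoc (α := fun _ => Fin n) ![] γ : Fin 1 → Fin n) (Fin.last 0) = γ := rfl
  have h3 : ∀ f : Fin (2 + 1) → ℝ, ∑ m, f m = f (0 : Fin 3) + f (1 : Fin 3) + f (2 : Fin 3) :=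
    Fin.sum_univ_three
  simp only [nabla, covD, e1, e6, h3, Fin.sum_univ_zero,
    Matrix.cons_val, e3, e4, e5]
  ring

theorem nabla_two (Γ : Coord n → Conn n) (T : Coord n → Ten n 0 2) (α δ γ : Fin n) :
    nabla Γ T x ![] ![α, δ, γ] = partialD γ (fun y => T y ![] ![α, δ]) x
      - ∑ μ, Γ x μ α γ * T x ![] ![μ, δ] - ∑ μ, Γ x μ δ γ * T x ![] ![α, μ] := by
  have e1 : (![α, δ, γ] : Fin 3 → Fin n) = Fin.snoc (α := fun _ => Fin n) ![α, δ] γ := by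
    funext i; fin_cases i <;> rfl
  have e3 : ∀ μ, Function.update ![α, δ] 0 μ = ![μ, δ] := fun μ => by
    funext i; fin_cases i <;> rfl
  have e4 : ∀ μ, Function.update ![α, δ] 1 μ = ![α, μ] := fun μ => by
    funext i; fin_cases i <;> rfl
  simp only [nabla, covD, e1, Fin.init_snoc, Fin.snoc_last, Fin.sum_univ_two, Fin.sum_univ_zero,
    Matrix.cons_val_zero, Matrix.cons_val_one, e3, e4, dualConn, neg_mul, Finset.sum_neg_distrib]
  ring

/-- Leibniz rule for lowering an index with a metric that need not be parallel: connection terms on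
the contracted index `δ` are inserted in both factors with opposite signs, and `c4` matches them. -/
theorem mixedDiv_lower (Γ : Coord n → Conn n) {G : Coord n → Fin n → Fin n → ℝ}
    {Y : Coord n → Fin n → Fin n → Fin n → ℝ} (α β : Fin n)
    (hG : ∀ δ, DifferentiableAt ℝ (fun y => G y α δ) x)
    (hY : ∀ δ γ, DifferentiableAt ℝ (fun y => Y y δ β γ) x) :
    mixedDiv Γ (fun y α β γ => ∑ δ, G y α δ * Y y δ β γ) x α β =
      (∑ δ, ∑ γ, (partialD γ (fun y => G y α δ) x - ∑ μ, Γ x μ α γ * G x μ δ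
        - ∑ μ, Γ x μ δ γ * G x α μ) * Y x δ β γ)
      + ∑ δ, G x α δ * ∑ γ, (partialD γ (fun y => Y y δ β γ) x + ∑ μ, Γ x δ μ γ * Y x μ β γ
        + ∑ μ, Γ x β μ γ * Y x δ μ γ + ∑ μ, Γ x γ μ γ * Y x δ β μ) := by
  have hp : ∀ γ, partialD γ (fun y => ∑ δ, G y α δ * Y y δ β γ) x =
      ∑ δ, (partialD γ (fun y => G y α δ) x * Y x δ β γ
        + G x α δ * partialD γ (fun y => Y y δ β γ) x) := fun γ => by
    rw [partialD_sum γ (F := fun δ y => G y α δ * Y y δ β γ) fun δ _ => (hG δ).mul (hY δ γ)]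
    exact Finset.sum_congr rfl fun δ _ => partialD_mul γ (hG δ) (hY δ γ)
  simp only [Finset.mul_sum]
  rw [Finset.sum_comm, Finset.sum_comm (f := fun δ γ => G x α δ * _), ← Finset.sum_add_distrib]
  refine Finset.sum_congr rfl fun γ _ => ?_
  rw [hp]
  have c1 : ∑ μ, Γ x μ α γ * ∑ δ, G x μ δ * Y x δ β γ =
      ∑ δ, (∑ μ, Γ x μ α γ * G x μ δ) * Y x δ β γ := by
    simp only [Finset.mul_sum, Finset.sum_mul]
    rw [Finset.sum_comm]
    simp only [mul_assoc]
  have c2 : ∑ μ, Γ x β μ γ * ∑ δ, G x α δ * Y x δ μ γ =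
      ∑ δ, G x α δ * ∑ μ, Γ x β μ γ * Y x δ μ γ := by
    simp only [Finset.mul_sum]
    rw [Finset.sum_comm]
    simp only [mul_left_comm]
  have c3 : ∑ μ, Γ x γ μ γ * ∑ δ, G x α δ * Y x δ β μ =
      ∑ δ, G x α δ * ∑ μ, Γ x γ μ γ * Y x δ β μ := by
    simp only [Finset.mul_sum]
    rw [Finset.sum_comm]
    simp only [mul_left_comm]
  have c4 : ∑ δ, (∑ μ, Γ x μ δ γ * G x α μ) * Y x δ β γ =
      ∑ δ, G x α δ * ∑ μ, Γ x δ μ γ * Y x μ β γ := by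
    simp only [Finset.mul_sum, Finset.sum_mul]
    rw [Finset.sum_comm]
    exact Finset.sum_congr rfl fun δ _ => Finset.sum_congr rfl fun μ _ => by ring
  rw [c1, c2, c3]
  simp only [sub_mul, mul_add, Finset.sum_add_distrib, Finset.sum_sub_distrib, c4]
  ring

end

/-! Smoothness -/

section
variable {n r s : ℕ} {Ω : Set (Coord n)}

theorem contDiffOn_ten_iff {T : Coord n → Ten n r s} :
    ContDiffOn ℝ ∞ T Ω ↔ ∀ A B, ContDiffOn ℝ ∞ (fun y => T y A B) Ω := by
  rw [contDiffOn_pi]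
  exact forall_congr' fun A => contDiffOn_pi

theorem differentiableAt_of_contDiffOn {E : Type*} [NormedAddCommGroup E] [NormedSpace ℝ E]
    (hΩ : IsOpen Ω) {F : Coord n → E} (hF : ContDiffOn ℝ ∞ F Ω) {x : Coord n} (hx : x ∈ Ω) :
    DifferentiableAt ℝ F x :=
  (hF.contDiffAt (hΩ.mem_nhds hx)).differentiableAt (by simp)

theorem contDiffOn_partialD (hΩ : IsOpen Ω) (k : Fin n) {F : Coord n → ℝ}
    (hF : ContDiffOn ℝ ∞ F Ω) : ContDiffOn ℝ ∞ (partialD k F) Ω :=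
  (hF.fderiv_of_isOpen hΩ (m := ∞) (by simp)).clm_apply contDiffOn_const

theorem contDiffOn_covD (hΩ : IsOpen Ω) {Γ : Coord n → Conn n} {Λ : Fin s → Coord n → Conn n}
    {T : Coord n → Ten n r s} (hΓ : ∀ i j k, ContDiffOn ℝ ∞ (fun x => Γ x i j k) Ω)
    (hΛ : ∀ m i j k, ContDiffOn ℝ ∞ (fun x => Λ m x i j k) Ω) (hT : ContDiffOn ℝ ∞ T Ω) :
    ContDiffOn ℝ ∞ (covD Γ Λ T) Ω := by
  rw [contDiffOn_ten_iff] at hT ⊢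
  intro A B
  exact ((contDiffOn_partialD hΩ _ (hT _ _)).add (ContDiffOn.sum fun m _ => ContDiffOn.sum
    fun l _ => (hΓ _ _ _).mul (hT _ _))).add (ContDiffOn.sum fun m _ => ContDiffOn.sum
    fun l _ => (hΛ _ _ _ _).mul (hT _ _))

theorem contDiffOn_nabla (hΩ : IsOpen Ω) {Γ : Coord n → Conn n} {T : Coord n → Ten n r s}
    (hΓ : ∀ i j k, ContDiffOn ℝ ∞ (fun x => Γ x i j k) Ω) (hT : ContDiffOn ℝ ∞ T Ω) :
    ContDiffOn ℝ ∞ (nabla Γ T) Ω :=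
  contDiffOn_covD hΩ hΓ (fun _ i j k => (hΓ i j k).neg) hT

theorem contDiffOn_divLast (hΩ : IsOpen Ω) {Γ : Coord n → Conn n} {T : Coord n → Ten n (r + 1) s}
    (hΓ : ∀ i j k, ContDiffOn ℝ ∞ (fun x => Γ x i j k) Ω) (hT : ContDiffOn ℝ ∞ T Ω) :
    ContDiffOn ℝ ∞ (divLast Γ T) Ω := by
  have h := contDiffOn_ten_iff.1 (contDiffOn_nabla hΩ hΓ hT)
  rw [contDiffOn_ten_iff]
  exact fun A B => ContDiffOn.sum fun k _ => h _ _

theorem contDiffOn_contractLower {F : Fin s → Coord n → Matrix (Fin n) (Fin n) ℝ}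
    {T : Coord n → Ten n r s} (hF : ∀ m i j, ContDiffOn ℝ ∞ (fun x => F m x i j) Ω)
    (hT : ContDiffOn ℝ ∞ T Ω) :
    ContDiffOn ℝ ∞ (fun x => contractLower (fun m => F m x) (T x)) Ω := by
  rw [contDiffOn_ten_iff] at hT ⊢
  exact fun A B => ContDiffOn.sum fun D _ =>
    (contDiffOn_prod fun m _ => hF m (D m) (B m)).mul (hT A D)

theorem contDiffOn_det {ι : Type*} [Fintype ι] [DecidableEq ι] {N : Coord n → Matrix ι ι ℝ}
    (hN : ∀ i j, ContDiffOn ℝ ∞ (fun x => N x i j) Ω) :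
    ContDiffOn ℝ ∞ (fun x => (N x).det) Ω := by
  simp only [Matrix.det_apply, Units.smul_def, zsmul_eq_mul]
  exact ContDiffOn.sum fun σ _ => contDiffOn_const.mul (contDiffOn_prod fun i _ => hN _ _)

/-- Cramer's rule: each entry is a quotient of determinants. -/
theorem contDiffOn_matrix_inv {N : Coord n → Matrix (Fin n) (Fin n) ℝ}
    (hN : ∀ i j, ContDiffOn ℝ ∞ (fun x => N x i j) Ω) (hdet : ∀ x ∈ Ω, (N x).det ≠ 0) (i j : Fin n) :
    ContDiffOn ℝ ∞ (fun x => (N x)⁻¹ i j) Ω := by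
  simp only [Matrix.inv_def, Ring.inverse_eq_inv', Matrix.smul_apply, smul_eq_mul,
    Matrix.adjugate_apply]
  refine ((contDiffOn_det hN).inv hdet).mul (contDiffOn_det fun a b => ?_)
  by_cases h : a = j
  · subst h; simpa using contDiffOn_const
  · simpa [h] using hN a b

end

/-! The arguments of the Lagrangian in a chart -/

section
variable {n : ℕ} {M : Type*} [TopologicalSpace M] [ChartedSpace (EuclideanSpace ℝ (Fin n)) M]
  {e : OpenPartialHomeomorph M (Coord n)} {r s : ℕ}

theorem TensorField.contDiffOn_comp (V : TensorField n M r s)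
    (he : e ∈ atlas (EuclideanSpace ℝ (Fin n)) M) : ContDiffOn ℝ ∞ (V.comp e) e.target :=
  contDiffOn_ten_iff.2 (V.smooth e he)

variable (X : LbarSpace n M)

theorem LbarSpace.contDiffOn_fMat (he : e ∈ atlas (EuclideanSpace ℝ (Fin n)) M) (i j : Fin n) :
    ContDiffOn ℝ ∞ (fun y => X.fMat e y i j) e.target :=
  X.f.smooth e he _ _

theorem contDiffOn_covD1 (V : TensorField n M r s)
    (he : e ∈ atlas (EuclideanSpace ℝ (Fin n)) M) : ContDiffOn ℝ ∞ (covD1 X V e) e.target :=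
  contDiffOn_covD e.open_target (X.Γ.smooth e he) (fun _ => X.P.smooth e he) (V.contDiffOn_comp he)

theorem snoc_apply_comm {α β : Type*} (F : Fin s → α → β) (G : α → β) (x : α) :
    (fun m => (Fin.snoc (α := fun _ => α → β) F G : Fin (s + 1) → α → β) m x) =
      Fin.snoc (α := fun _ => β) (fun m => F m x) (G x) := by
  funext m
  refine Fin.lastCases ?_ (fun i => ?_) m <;> simp

theorem contDiffOn_jetOf_value (V : TensorField n M r s)
    (he : e ∈ atlas (EuclideanSpace ℝ (Fin n)) M) :
    ContDiffOn ℝ ∞ (fun x => (jetOf X V e x).1) e.target :=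
  contDiffOn_contractLower (F := fun _ => X.fMat e) (fun _ => X.contDiffOn_fMat he)
    (V.contDiffOn_comp he)

/-- From here on the barred jet depends on `P` and `f` only through the barred value of the field.
-/
theorem jetOf_first (V : TensorField n M r s) (he : e ∈ atlas (EuclideanSpace ℝ (Fin n)) M)
    {x : Coord n} (hx : x ∈ e.target) :
    (jetOf X V e x).2.1 = nabla (X.Γ.coeff e) (fun y => (jetOf X V e y).1) x :=
  (nabla_contractLower (F := fun _ => X.fMat e) (Λ := fun _ => X.P.coeff e)
    (fun _ i j => differentiableAt_of_contDiffOn e.open_target (X.contDiffOn_fMat he i j) hx)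
    (differentiableAt_of_contDiffOn e.open_target (V.contDiffOn_comp he) hx)
    fun _ i j k => X.f_compatible e he x hx i j k).symm

theorem jetOf_second (V : TensorField n M r s) (he : e ∈ atlas (EuclideanSpace ℝ (Fin n)) M)
    {x : Coord n} (hx : x ∈ e.target) :
    (jetOf X V e x).2.2 = nabla (X.Γ.coeff e) (fun y => (jetOf X V e y).2.1) x := by
  -- The differentiation index is contracted with the identity and carries the dual of `Γ`, so the
  -- compatibility condition in that slot reads `0 = Γ - Γ`.
  let F : Fin (s + 1) → Coord n → Matrix (Fin n) (Fin n) ℝ :=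
    Fin.snoc (α := fun _ => Coord n → Matrix (Fin n) (Fin n) ℝ) (fun _ => X.fMat e) (fun _ => 1)
  have hF : ∀ y, (fun m => F m y) =
      Fin.snoc (α := fun _ => Matrix (Fin n) (Fin n) ℝ) (fun _ => X.fMat e y) 1 :=
    fun y => snoc_apply_comm _ _ y
  have h := nabla_contractLower (Γ := X.Γ.coeff e) (F := F) (T := covD1 X V e) (x := x)
    (Λ := Fin.snoc (α := fun _ => Coord n → Conn n) (fun _ => X.P.coeff e)
      (dualConn (X.Γ.coeff e))) ?_
    (differentiableAt_of_contDiffOn e.open_target (contDiffOn_covD1 X V he) hx) ?_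
  · simp only [hF] at h
    exact h.symm
  · intro m i j
    refine Fin.lastCases ?_ (fun m => ?_) m
    · simp [F]
    · simpa [F] using differentiableAt_of_contDiffOn e.open_target (X.contDiffOn_fMat he i j) hx
  · intro m i j k
    refine Fin.lastCases ?_ (fun m => ?_) m
    · simp [F, partialD, dualConn, Matrix.one_apply]
    · simp only [F, Fin.snoc_castSucc]
      exact X.f_compatible e he x hx i j k

theorem contDiffOn_jetOf_first (V : TensorField n M r s)
    (he : e ∈ atlas (EuclideanSpace ℝ (Fin n)) M) :
    ContDiffOn ℝ ∞ (fun x => (jetOf X V e x).2.1) e.target :=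
  (contDiffOn_nabla e.open_target (X.Γ.smooth e he) (contDiffOn_jetOf_value X V he)).congr
    fun _ hx => jetOf_first X V he hx

theorem contDiffOn_jetOf (V : TensorField n M r s)
    (he : e ∈ atlas (EuclideanSpace ℝ (Fin n)) M) : ContDiffOn ℝ ∞ (jetOf X V e) e.target :=
  (contDiffOn_jetOf_value X V he).prodMk ((contDiffOn_jetOf_first X V he).prodMk
    ((contDiffOn_nabla e.open_target (X.Γ.smooth e he) (contDiffOn_jetOf_first X V he)).congr
      fun _ hx => jetOf_second X V he hx))

theorem jetOf_second_eq_nabla_nabla (V : TensorField n M r s)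
    (he : e ∈ atlas (EuclideanSpace ℝ (Fin n)) M) {x : Coord n} (hx : x ∈ e.target) :
    (jetOf X V e x).2.2 =
      nabla (X.Γ.coeff e) (nabla (X.Γ.coeff e) fun y => (jetOf X V e y).1) x := by
  rw [jetOf_second X V he hx]
  refine nabla_congr ?_
  filter_upwards [e.open_target.mem_nhds hx] with y hy
  exact jetOf_first X V he hy

/-! The metric -/

theorem gBar_eq_jetOf (x : Coord n) (i j : Fin n) :
    X.gBar e x i j = (jetOf X X.g e x).1 ![] ![i, j] := by
  simp only [LbarSpace.gBar, jetOf, contractLower]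
  rw [← (finTwoArrowEquiv (Fin n)).symm.sum_comp, Fintype.sum_prod_type]
  simp [finTwoArrowEquiv, Fin.prod_univ_two]

/-- The barred metric is congruent to `g` through `f`, hence inherits nondegeneracy. -/
theorem gBar_eq_mul (x : Coord n) :
    X.gBar e x = (X.fMat e x).transpose *
      Matrix.of (fun i j => X.g.comp e x ![] ![i, j]) * X.fMat e x := by
  ext i j
  simp only [LbarSpace.gBar, Matrix.mul_apply, Matrix.transpose_apply, Matrix.of_apply,
    Finset.sum_mul]
  rw [Finset.sum_comm]
  exact Finset.sum_congr rfl fun k _ => Finset.sum_congr rfl fun l _ => by ring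

theorem gBar_det_ne_zero (he : e ∈ atlas (EuclideanSpace ℝ (Fin n)) M) {x : Coord n}
    (hx : x ∈ e.target) : (X.gBar e x).det ≠ 0 := by
  have hf : (X.fMat e x).det ≠ 0 := X.f_nondegenerate e he x hx
  have hg := X.g_nondegenerate e he x hx
  rw [gBar_eq_mul, Matrix.det_mul, Matrix.det_mul, Matrix.det_transpose]
  exact mul_ne_zero (mul_ne_zero hf hg) hf

theorem contDiffOn_gBar (he : e ∈ atlas (EuclideanSpace ℝ (Fin n)) M) (i j : Fin n) :
    ContDiffOn ℝ ∞ (fun x => X.gBar e x i j) e.target := by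
  simp only [gBar_eq_jetOf]
  exact contDiffOn_ten_iff.1 (contDiffOn_jetOf_value X X.g he) _ _

theorem contDiffOn_gInv (he : e ∈ atlas (EuclideanSpace ℝ (Fin n)) M) (i j : Fin n) :
    ContDiffOn ℝ ∞ (fun x => X.gInv e x i j) e.target :=
  contDiffOn_matrix_inv (contDiffOn_gBar X he) (fun _ hx => gBar_det_ne_zero X he hx) i j

theorem sum_gBar_mul_sum_gInv (he : e ∈ atlas (EuclideanSpace ℝ (Fin n)) M) {x : Coord n}
    (hx : x ∈ e.target) (v : Fin n → ℝ) (α : Fin n) :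
    ∑ δ, X.gBar e x α δ * ∑ μ, X.gInv e x δ μ * v μ = v α := by
  have h : X.gBar e x * X.gInv e x = 1 :=
    Matrix.mul_nonsing_inv _ (isUnit_iff_ne_zero.2 (gBar_det_ne_zero X he hx))
  have := congrFun (congrArg (fun N => Matrix.mulVec N v) h) α
  rwa [← Matrix.mulVec_mulVec, Matrix.one_mulVec] at this

end

/-! The momenta of a Lagrangian system -/

section
variable {n r s : ℕ}

open Classical in
theorem linearMap_eq_pair (ℓ : Ten n r s →ₗ[ℝ] ℝ) (T : Ten n r s) :
    ℓ T = pair (fun B A => ℓ (Pi.single A (Pi.single B 1))) T := by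
  have h : T = ∑ A, ∑ B, T A B • (Pi.single A (Pi.single B (1 : ℝ)) : Ten n r s) := by
    funext A B
    simp only [Finset.sum_apply, Pi.smul_apply, smul_eq_mul]
    rw [Finset.sum_eq_single A, Finset.sum_eq_single B]
    · simp
    · intro B' _ hB; simp [hB.symm]
    · simp
    · intro A' _ hA; simp [hA.symm]
    · simp
  conv_lhs => rw [h]
  simp [pair, mul_comm]

end

namespace LagrangianSystem

variable {n : ℕ} {M : Type*} [TopologicalSpace M] [ChartedSpace (EuclideanSpace ℝ (Fin n)) M]
  {ι : Type*} [Fintype ι] {τ : ι → ℕ × ℕ} (Λ : LagrangianSystem n M τ)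
  {e : OpenPartialHomeomorph M (Coord n)}

/-- The momenta are the components of the differential of `L`; this puts the invariance condition
into the form required by the Noether identity. -/
theorem fderiv_eq_sum_pair (e : OpenPartialHomeomorph M (Coord n)) (x : Coord n)
    (v : JetSpace n τ) :
    fderiv ℝ Λ.lagr.toFun (Λ.jet e x) v =
      ∑ c, (pair (Λ.mom0 e c x) (v c).1 + pair (Λ.mom1 e c x) (v c).2.1
        + pair (Λ.mom2 e c x) (v c).2.2) := by
  classical
  set D := fderiv ℝ Λ.lagr.toFun (Λ.jet e x) with hD
  have hv : D v = ∑ c, D (Pi.single c (v c)) := by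
    rw [← map_sum, Finset.univ_sum_single]
  rw [hv]
  refine Finset.sum_congr rfl fun c _ => ?_
  let i : Jet n (rank τ c).1 (rank τ c).2 →ₗ[ℝ] JetSpace n τ :=
    LinearMap.single ℝ (fun c => Jet n (rank τ c).1 (rank τ c).2) c
  let i0 : Ten n (rank τ c).1 (rank τ c).2 →ₗ[ℝ] Jet n (rank τ c).1 (rank τ c).2 :=
    LinearMap.inl ℝ _ _
  let i1 : Ten n (rank τ c).1 ((rank τ c).2 + 1) →ₗ[ℝ] Jet n (rank τ c).1 (rank τ c).2 :=
    LinearMap.inr ℝ _ _ ∘ₗ LinearMap.inl ℝ _ _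
  let i2 : Ten n (rank τ c).1 ((rank τ c).2 + 2) →ₗ[ℝ] Jet n (rank τ c).1 (rank τ c).2 :=
    LinearMap.inr ℝ _ _ ∘ₗ LinearMap.inr ℝ _ _
  have hsplit : (Pi.single c (v c) : JetSpace n τ) =
      i (i0 (v c).1) + i (i1 (v c).2.1) + i (i2 (v c).2.2) := by
    rw [← map_add, ← map_add]
    simp [i, i0, i1, i2]
  rw [hsplit, map_add, map_add]
  have e0 := linearMap_eq_pair ((D : JetSpace n τ →ₗ[ℝ] ℝ) ∘ₗ i ∘ₗ i0) (v c).1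
  have e1 := linearMap_eq_pair ((D : JetSpace n τ →ₗ[ℝ] ℝ) ∘ₗ i ∘ₗ i1) (v c).2.1
  have e2 := linearMap_eq_pair ((D : JetSpace n τ →ₗ[ℝ] ℝ) ∘ₗ i ∘ₗ i2) (v c).2.2
  have m0 : Λ.mom0 e c x = fun B A => ((D : JetSpace n τ →ₗ[ℝ] ℝ) ∘ₗ i ∘ₗ i0)
      (Pi.single A (Pi.single B 1)) := by
    funext B A
    simp only [mom0, LinearMap.comp_apply, i, i0]
    congr!
  have m1 : Λ.mom1 e c x = fun B A => ((D : JetSpace n τ →ₗ[ℝ] ℝ) ∘ₗ i ∘ₗ i1)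
      (Pi.single A (Pi.single B 1)) := by
    funext B A
    simp only [mom1, LinearMap.comp_apply, i, i1]
    congr!
  have m2 : Λ.mom2 e c x = fun B A => ((D : JetSpace n τ →ₗ[ℝ] ℝ) ∘ₗ i ∘ₗ i2)
      (Pi.single A (Pi.single B 1)) := by
    funext B A
    simp only [mom2, LinearMap.comp_apply, i, i2]
    congr!
  rw [m0, m1, m2]
  exact congrArg₂ (· + ·) (congrArg₂ (· + ·) e0 e1) e2

theorem contDiffOn_jet (he : e ∈ atlas (EuclideanSpace ℝ (Fin n)) M) :
    ContDiffOn ℝ ∞ (Λ.jet e) e.target :=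
  contDiffOn_pi.2 fun c => contDiffOn_jetOf Λ.X (allFields Λ.X Λ.V c) he

theorem contDiffOn_fderiv_lagr (he : e ∈ atlas (EuclideanSpace ℝ (Fin n)) M) (v : JetSpace n τ) :
    ContDiffOn ℝ ∞ (fun x => fderiv ℝ Λ.lagr.toFun (Λ.jet e x) v) e.target :=
  ((Λ.lagr.smooth.fderiv_of_isOpen Λ.lagr.isOpen_dom (m := ∞) (by simp)).comp
    (Λ.contDiffOn_jet he) fun x hx => Λ.jet_mem e he x hx).clm_apply contDiffOn_const

theorem contDiffOn_mom1 (he : e ∈ atlas (EuclideanSpace ℝ (Fin n)) M) (c : Option ι) :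
    ContDiffOn ℝ ∞ (Λ.mom1 e c) e.target :=
  contDiffOn_ten_iff.2 fun _ _ => Λ.contDiffOn_fderiv_lagr he _

theorem contDiffOn_mom2 (he : e ∈ atlas (EuclideanSpace ℝ (Fin n)) M) (c : Option ι) :
    ContDiffOn ℝ ∞ (Λ.mom2 e c) e.target :=
  contDiffOn_ten_iff.2 fun _ _ => Λ.contDiffOn_fderiv_lagr he _

theorem contDiffOn_canMom (he : e ∈ atlas (EuclideanSpace ℝ (Fin n)) M) (c : Option ι) :
    ContDiffOn ℝ ∞ (Λ.canMom e c) e.target :=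
  (Λ.contDiffOn_mom1 he c).sub
    (contDiffOn_divLast e.open_target (Λ.X.Γ.smooth e he) (Λ.contDiffOn_mom2 he c))

/-! The spin-type tensor -/

/-- The value of a field variable, all covariant indices contracted. -/
def fieldValue (e : OpenPartialHomeomorph M (Coord n)) (c : Option ι) (x : Coord n) :
    Ten n (rank τ c).1 (rank τ c).2 :=
  (Λ.jet e x c).1

theorem contDiffOn_fieldValue (he : e ∈ atlas (EuclideanSpace ℝ (Fin n)) M) (c : Option ι) :
    ContDiffOn ℝ ∞ (Λ.fieldValue e c) e.target :=
  contDiffOn_jetOf_value Λ.X (allFields Λ.X Λ.V c) he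

theorem spin_eq_sum_fieldSpin (he : e ∈ atlas (EuclideanSpace ℝ (Fin n)) M) {x : Coord n}
    (hx : x ∈ e.target) :
    Λ.spin e x = fun α β γ => ∑ c, fieldSpin (Λ.X.Γ.coeff e) (Λ.canMom e c) (Λ.mom2 e c)
      (Λ.fieldValue e c) x α β γ := by
  funext α β γ
  refine Finset.sum_congr rfl fun c _ => ?_
  have h1 : nabla (Λ.X.Γ.coeff e) (Λ.fieldValue e c) x = (Λ.jet e x c).2.1 :=
    (jetOf_first Λ.X (allFields Λ.X Λ.V c) he hx).symm
  rw [fieldSpin, h1]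
  simp only [pair, Finset.sum_add_distrib]
  congr 2
  rw [Finset.sum_comm (s := Finset.univ (α := Fin n))]
  exact Finset.sum_congr rfl fun A _ => Finset.sum_comm

theorem differentiableAt_spin (he : e ∈ atlas (EuclideanSpace ℝ (Fin n)) M) {x : Coord n}
    (hx : x ∈ e.target) (α β γ : Fin n) : DifferentiableAt ℝ (fun y => Λ.spin e y α β γ) x := by
  have h : (fun y => Λ.spin e y α β γ) =ᶠ[nhds x] fun y => ∑ c, fieldSpin (Λ.X.Γ.coeff e)
      (Λ.canMom e c) (Λ.mom2 e c) (Λ.fieldValue e c) y α β γ := by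
    filter_upwards [e.open_target.mem_nhds hx] with y hy
    rw [Λ.spin_eq_sum_fieldSpin he hy]
  refine DifferentiableAt.congr_of_eventuallyEq (DifferentiableAt.fun_sum fun c _ => ?_) h
  have hv := Λ.contDiffOn_fieldValue he c
  exact differentiableAt_fieldSpin
    (differentiableAt_of_contDiffOn e.open_target (Λ.contDiffOn_canMom he c) hx)
    (differentiableAt_of_contDiffOn e.open_target (Λ.contDiffOn_mom2 he c) hx)
    (differentiableAt_of_contDiffOn e.open_target hv hx)
    (differentiableAt_of_contDiffOn e.open_target
      (contDiffOn_nabla e.open_target (Λ.X.Γ.smooth e he) hv) hx) α β γ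

theorem differentiableAt_spinUp (he : e ∈ atlas (EuclideanSpace ℝ (Fin n)) M) {x : Coord n}
    (hx : x ∈ e.target) (α β γ : Fin n) : DifferentiableAt ℝ (fun y => Λ.spinUp e y α β γ) x :=
  DifferentiableAt.fun_sum fun δ _ =>
    (differentiableAt_of_contDiffOn e.open_target (contDiffOn_gInv Λ.X he α δ) hx).mul
      (Λ.differentiableAt_spin he hx δ β γ)

theorem differentiableAt_spinAnti (he : e ∈ atlas (EuclideanSpace ℝ (Fin n)) M) {x : Coord n}
    (hx : x ∈ e.target) (α β γ : Fin n) : DifferentiableAt ℝ (fun y => Λ.spinAnti e y α β γ) x := by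
  simp only [spinAnti, div_eq_mul_inv]
  exact ((Λ.differentiableAt_spinUp he hx α β γ).fun_sub
    (Λ.differentiableAt_spinUp he hx β α γ)).mul_const _

theorem differentiableAt_belinfante (he : e ∈ atlas (EuclideanSpace ℝ (Fin n)) M) {x : Coord n}
    (hx : x ∈ e.target) (α β γ : Fin n) :
    DifferentiableAt ℝ (fun y => Λ.belinfante e y α β γ) x :=
  ((Λ.differentiableAt_spinAnti he hx α β γ).add (Λ.differentiableAt_spinAnti he hx γ α β)).add
    (Λ.differentiableAt_spinAnti he hx γ β α)

theorem differentiableAt_spinSym (he : e ∈ atlas (EuclideanSpace ℝ (Fin n)) M) {x : Coord n}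
    (hx : x ∈ e.target) (α β γ : Fin n) : DifferentiableAt ℝ (fun y => Λ.spinSym e y α β γ) x :=
  (Λ.differentiableAt_spinUp he hx α β γ).sub (Λ.differentiableAt_belinfante he hx α β γ)

/-! The relation between the three energy-momentum tensors -/

/-- `K` and the viscosity tensor are, up to sign, the two Leibniz terms of `div (gΨ)`, and `gΨ = U +
W`. Only `Ψ = U - B` enters; the symmetries of `B` and `Ψ` play no role. -/
theorem theta_sub_sT_eq (he : e ∈ atlas (EuclideanSpace ℝ (Fin n)) M) {x : Coord n}
    (hx : x ∈ e.target) (α β : Fin n) :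
    Λ.theta e x α β - Λ.sT e x α β =
      Λ.canonical e x α β + (if α = β then Λ.L e x else 0)
        + mixedDiv (Λ.X.Γ.coeff e) (Λ.spin e) x α β := by
  have dG : ∀ δ, DifferentiableAt ℝ (fun y => Λ.X.gBar e y α δ) x := fun δ =>
    differentiableAt_of_contDiffOn e.open_target (contDiffOn_gBar Λ.X he α δ) hx
  have dW : ∀ γ, DifferentiableAt ℝ (fun y => Λ.superpotential e y α β γ) x := fun γ =>
    (DifferentiableAt.fun_sum fun δ _ =>
      (dG δ).mul (Λ.differentiableAt_belinfante he hx δ β γ)).neg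
  have dU := fun γ => Λ.differentiableAt_spin he hx α β γ
  -- Lowering the index raised by `g⁻¹` returns `U`, and `W = -gB`.
  have hsum : (fun y α β γ => ∑ δ, Λ.X.gBar e y α δ * Λ.spinSym e y δ β γ) =ᶠ[nhds x]
      fun y α β γ => Λ.spin e y α β γ + Λ.superpotential e y α β γ := by
    filter_upwards [e.open_target.mem_nhds hx] with y hy
    funext α β γ
    have h := sum_gBar_mul_sum_gInv Λ.X he hy (fun μ => Λ.spin e y μ β γ) α
    simp only [spinSym, superpotential, mul_sub, Finset.sum_sub_distrib]
    rw [← h]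
    rfl
  have h1 := mixedDiv_lower (Λ.X.Γ.coeff e) (G := Λ.X.gBar e) (Y := Λ.spinSym e) α β dG
    fun δ γ => Λ.differentiableAt_spinSym he hx δ β γ
  rw [mixedDiv_congr hsum, mixedDiv_add (Λ.X.Γ.coeff e) α β dU dW] at h1
  have hK : Λ.nonmetricity e x α β = - ∑ δ, ∑ γ,
      (partialD γ (fun y => Λ.X.gBar e y α δ) x
        - ∑ μ, Λ.X.Γ.coeff e x μ α γ * Λ.X.gBar e x μ δ
        - ∑ μ, Λ.X.Γ.coeff e x μ δ γ * Λ.X.gBar e x α μ) * Λ.spinSym e x δ β γ := by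
    simp only [nonmetricity, jetOf_first Λ.X Λ.X.g he hx, nabla_two, gBar_eq_jetOf]
  have hV : Λ.viscosity e x α β = - ∑ δ, Λ.X.gBar e x α δ *
      ∑ γ, (partialD γ (fun y => Λ.spinSym e y δ β γ) x
        + ∑ μ, Λ.X.Γ.coeff e x δ μ γ * Λ.spinSym e x μ β γ
        + ∑ μ, Λ.X.Γ.coeff e x β μ γ * Λ.spinSym e x δ μ γ
        + ∑ μ, Λ.X.Γ.coeff e x γ μ γ * Λ.spinSym e x δ β μ) := by
    simp only [viscosity, divLast_three]
  rw [theta, sT, divLast_oneOne, hK, hV]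
  linear_combination -h1

/-- The sum of `noether_identity` over all field variables, the metric included. -/
theorem canonical_add_mixedDiv_spin (he : e ∈ atlas (EuclideanSpace ℝ (Fin n)) M) {x : Coord n}
    (hx : x ∈ e.target) (α β : Fin n) :
    Λ.canonical e x α β + (if α = β then Λ.L e x else 0)
        + mixedDiv (Λ.X.Γ.coeff e) (Λ.spin e) x α β = Λ.Q e x α β := by
  set Γ := Λ.X.Γ.coeff e with hΓ
  have h1 : ∀ c, nabla Γ (Λ.fieldValue e c) x = (Λ.jet e x c).2.1 := fun c =>
    (jetOf_first Λ.X (allFields Λ.X Λ.V c) he hx).symm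
  have h2 : ∀ c, nabla Γ (nabla Γ (Λ.fieldValue e c)) x = (Λ.jet e x c).2.2 := fun c =>
    (jetOf_second_eq_nabla_nabla Λ.X (allFields Λ.X Λ.V c) he hx).symm
  have dv := fun c => Λ.contDiffOn_fieldValue he c
  have dT := fun c => differentiableAt_of_contDiffOn e.open_target (dv c) hx
  have dT1 := fun c => differentiableAt_of_contDiffOn e.open_target
    (contDiffOn_nabla e.open_target (Λ.X.Γ.smooth e he) (dv c)) hx
  have dm1 := fun c => differentiableAt_of_contDiffOn e.open_target (Λ.contDiffOn_mom1 he c) hx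
  have dm2 := fun c => differentiableAt_of_contDiffOn e.open_target (Λ.contDiffOn_mom2 he c) hx
  have dcm := fun c => differentiableAt_of_contDiffOn e.open_target (Λ.contDiffOn_canMom he c) hx
  have dq := fun c => differentiableAt_of_contDiffOn e.open_target
    (contDiffOn_divLast e.open_target (Λ.X.Γ.smooth e he) (Λ.contDiffOn_mom2 he c)) hx
  have hspin : Λ.spin e =ᶠ[nhds x] fun y α β γ => ∑ c, fieldSpin Γ (Λ.canMom e c) (Λ.mom2 e c)
      (Λ.fieldValue e c) y α β γ := by
    filter_upwards [e.open_target.mem_nhds hx] with y hy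
    exact Λ.spin_eq_sum_fieldSpin he hy
  have hinv := fderiv_lieJet Λ.lagr (Λ.jet_mem e he x hx) α β
  rw [show (fun c => jetOf Λ.X (allFields Λ.X Λ.V c) e x) = Λ.jet e x from rfl,
    Λ.fderiv_eq_sum_pair] at hinv
  have hcan : Λ.canonical e x α β + (if α = β then Λ.L e x else 0) =
      ∑ c, (pair (upperSlice (Λ.canMom e c x) β) (lowerSlice (Λ.jet e x c).2.1 α)
        + ∑ k, pair (upperSlice (upperSlice (Λ.mom2 e c x) β) k)
          (lowerSlice (lowerSlice (Λ.jet e x c).2.2 α) k)) := by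
    rw [canonical, sub_add_cancel]
    refine Finset.sum_congr rfl fun c _ => ?_
    simp only [pair, Finset.sum_add_distrib]
    congr 1
    rw [Finset.sum_comm (s := Finset.univ (α := Fin n))]
    exact Finset.sum_congr rfl fun A _ => Finset.sum_comm
  have hQ : Λ.Q e x α β = ∑ c, - pair (Λ.mom0 e c x - divLast Γ (Λ.mom1 e c) x
      + divLast Γ (divLast Γ (Λ.mom2 e c)) x) (lieGen α β (Λ.fieldValue e c x)) := by
    rw [Fintype.sum_option]; rfl
  have key := fun c => noether_identity (Λ.mom0 e c x) (dm1 c) (dm2 c) (dq c) (dT c) (dT1 c) α β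
  -- The zero added on the right is rewritten as the variation of `L` under `gl(n)`: the
  -- contributions of single fields need not vanish, only their sum does, and with them the identity
  -- holds field by field.
  rw [mixedDiv_congr hspin, mixedDiv_sum Γ α β fun c γ => differentiableAt_fieldSpin (dcm c)
    (dm2 c) (dT c) (dT1 c) α β γ, hcan, hQ, add_comm, ← Finset.sum_add_distrib, ← add_zero
    (∑ c, -pair _ _), ← hinv, ← Finset.sum_add_distrib]
  refine Finset.sum_congr rfl fun c _ => ?_
  have := key c
  rw [h1, h2] at this
  exact this

/-- The covariant Noether identity for the three energy-momentum tensors. -/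
theorem theta_sub_sT (he : e ∈ atlas (EuclideanSpace ℝ (Fin n)) M) {x : Coord n}
    (hx : x ∈ e.target) (α β : Fin n) :
    Λ.theta e x α β - Λ.sT e x α β = Λ.Q e x α β := by
  rw [Λ.theta_sub_sT_eq he hx, Λ.canonical_add_mixedDiv_spin he hx]

/-! ### Rest mass densities -/

theorem rhoThetaIn_sub_rhoTIn (u : TensorField n M 1 0)
    (he : e ∈ atlas (EuclideanSpace ℝ (Fin n)) M) {p : M} (hp : p ∈ e.source) :
    Λ.rhoThetaIn u e p - Λ.rhoTIn u e p = - Λ.rhoQIn u e p := by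
  simp only [rhoThetaIn, rhoTIn, rhoQIn, LbarSpace.uProjection, neg_neg,
    ← Λ.theta_sub_sT he (e.map_source hp), mul_sub, sub_mul, Finset.sum_sub_distrib]

theorem rhoThetaIn_eq_rhoTIn_iff (u : TensorField n M 1 0)
    (he : e ∈ atlas (EuclideanSpace ℝ (Fin n)) M) {p : M} (hp : p ∈ e.source) :
    Λ.rhoThetaIn u e p = Λ.rhoTIn u e p ↔ Λ.rhoQIn u e p = 0 := by
  rw [← sub_eq_zero, Λ.rhoThetaIn_sub_rhoTIn u he hp, neg_eq_zero]

end LagrangianSystem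

end LbarGeometry

end

theorem mainTheorem1 {n : ℕ} {M : Type*} [TopologicalSpace M]
    [ChartedSpace (EuclideanSpace ℝ (Fin n)) M] [IsManifold (𝓡 n) ∞ M]
    {ι : Type*} [Fintype ι] {τ : ι → ℕ × ℕ}
    (Λ : LbarGeometry.LagrangianSystem n M τ)
    (u : LbarGeometry.TensorField n M 1 0) (hu : Λ.X.NonNull u) :
    (Λ.rhoTheta u = Λ.rhoT u ↔ Λ.rhoQ u = 0) ∧
      (∀ e ∈ atlas (EuclideanSpace ℝ (Fin n)) M, ∀ p ∈ e.source,
        (Λ.rhoThetaIn u e p = Λ.rhoTIn u e p ↔ Λ.rhoQIn u e p = 0)) := by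
  refine ⟨?_, fun e he p hp => Λ.rhoThetaIn_eq_rhoTIn_iff u he hp⟩
  -- The global densities are computed at each point in its preferred chart, which belongs to the
  -- atlas, so the chartwise equivalence applies directly.
  rw [funext_iff, funext_iff]
  exact forall_congr' fun p =>
    Λ.rhoThetaIn_eq_rhoTIn_iff u (chart_mem_atlas _ p) (mem_chart_source _ p)
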